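/- Let $(X,\mathsf d)$ be a complete separable metric space and let $\mathfrak m$ be a nonnegative Borel measure on $X$ with $\operatorname{supp}\mathfrak m=X$ such that, for some $o\in X$ and $\kappa\ge 0$, $\mathfrak m(\{x:\mathsf d(x,o)<r\})\le e^{\kappa r^2}$ for every $r>0$. For $f:X\to\mathbb R$ let $$|\mathrm Df|(x):=\limsup_{y\to x}\frac{|f(y)-f(x)|}{\mathsf d(x,y)}\qquad(|\mathrm Df|(x):=0\text{ if }x\text{ is isolated}),$$ and let $\mathsf{Ch}:L^2(X,\mathfrak m)\to[0,\infty]$ be the Cheeger energy $$\mathsf{Ch}(f):=\inf\Big\{\liminf_{n\to\infty}\tfrac12\int_X|\mathrm Df_n|^2\,d\mathfrak m:\ f_n\in L^2(X,\mathfrak m)\text{ bounded and Lipschitz},\ f_n\to f\text{ in }L^2(X,\mathfrak m)\Big\}.$$ Its subdifferential at $f$ with $\mathsf{Ch}(f)<\infty$ is $\partial\mathsf{Ch}(f)=\{l\in L^2(X,\mathfrak m):\int_X l(h-f)\,d\mathfrak m\le\mathsf{Ch}(h)-\mathsf{Ch}(f)\ \ \forall h\in L^2(X,\mathfrak m)\}$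 (and it is empty if $\mathsf{Ch}(f)=\infty$). The $L^2$ heat flow starting from $f\in L^2(X,\mathfrak m)$ is the curve $t\mapsto \mathsf P_tf\in L^2(X,\mathfrak m)$, $t\ge0$, with $\mathsf P_0f=f$, locally absolutely continuous in $(0,\infty)$, with $\mathsf P_tf\to f$ in $L^2(X,\mathfrak m)$ as $t\downarrow0$ and $\frac{d}{dt}\mathsf P_tf\in-\partial\mathsf{Ch}(\mathsf P_tf)$ for a.e. $t>0$. The heat semigroup $(\mathsf P_t)_{t\ge0}$ on $L^1(X,\mathfrak m)$ is the (possibly nonlinear) family of continuous maps $\mathsf P_t:L^1(X,\mathfrak m)\to L^1(X,\mathfrak m)$ that coincides with the $L^2$ heat flow on $L^1\cap L^2(X,\mathfrak m)$. Then the heat semigroup on $L^1(X,\mathfrak m)$ exists and is unique, and for all nonnegative $f,g\in L^1(X,\mathfrak m)$ and every $t\ge0$ the functions $\mathsf P_tf,\mathsf P_tg$ are nonnegative and $$\mathsf{He}_p(\mathsf P_tf,\mathsf P_tg)\le\mathsf{He}_p(f,g)\qquad\text{for every }p\in[1,\infty),$$ where $\mathsf{He}_p(f,g):=\Big(\int_X\big|f^{1/p}-g^{1/p}\big|^p\,d\mathfrak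 m\Big)^{1/p}$ is the $p$-Hellinger--Kakutani distance. -/

import Mathlib

open MeasureTheory Filter Topology Set
open scoped NNReal ENNReal

noncomputable section

namespace HeatHellinger

/-- The slope (local Lipschitz constant) `|D f|(x) = limsup_{y → x} |f y - f x| / d(x, y)`. It is a
limsup over the punctured neighbourhoods of `x`, hence equals `0` when `x` is isolated. -/
def slope {X : Type*} [MetricSpace X] (f : X → ℝ) (x : X) : ℝ≥0∞ :=
  limsup (fun y => edist (f y) (f x) / edist y x) (𝓝[≠] x)

/-- The class `Lip_b(X)` of bounded Lipschitz functions. -/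
def IsLipB {X : Type*} [MetricSpace X] (f : X → ℝ) : Prop :=
  (∃ K : ℝ≥0, LipschitzWith K f) ∧ ∃ C : ℝ, ∀ x, |f x| ≤ C

/-- The Cheeger energy `Ch : L²(X, m) → [0, ∞]`: the infimum of
`liminf_n (1/2) ∫ |D F_n|² dm` over all sequences of bounded Lipschitz functions `F_n`
that converge to `f` in `L²(X, m)`. -/
def cheeger {X : Type*} [MetricSpace X] [MeasurableSpace X] (m : Measure X)
    (f : Lp ℝ 2 m) : ℝ≥0∞ :=
  sInf {c | ∃ F : ℕ → X → ℝ,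
    (∀ n, IsLipB (F n) ∧ MemLp (F n) 2 m) ∧
    Tendsto (fun n => eLpNorm (fun x => F n x - f x) 2 m) atTop (𝓝 0) ∧
    c = liminf (fun n => 2⁻¹ * ∫⁻ x, slope (F n) x ^ 2 ∂m) atTop}

/-- The `L²` subdifferential of the Cheeger energy: `l ∈ ∂Ch(f)` iff `Ch(f) < ∞` and
`⟨l, g - f⟩ ≤ Ch(g) - Ch(f)` for every `g ∈ L²`
(the inequality is trivial when `Ch(g) = ∞`). -/
def cheegerSubdifferential {X : Type*} [MetricSpace X] [MeasurableSpace X] (m : Measure X)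
    (f : Lp ℝ 2 m) : Set (Lp ℝ 2 m) :=
  {l | cheeger m f ≠ ∞ ∧ ∀ g : Lp ℝ 2 m, cheeger m g ≠ ∞ →
    inner ℝ l (g - f) ≤ (cheeger m g).toReal - (cheeger m f).toReal}

/-- `u` is the `L²` gradient flow of the Cheeger energy starting from `f`: `u` is locally
absolutely continuous in `(0, ∞)`, `u t → f = u 0` as `t ↓ 0`, and `u' ∈ -∂Ch(u)` a.e. -/
structure IsL2HeatFlow {X : Type*} [MetricSpace X] [MeasurableSpace X] (m : Measure X)
    (f : Lp ℝ 2 m) (u : ℝ → Lp ℝ 2 m) : Prop where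
  initial : u 0 = f
  tendsto_initial : Tendsto u (𝓝[>] 0) (𝓝 f)
  absolutelyContinuous : ∀ a b : ℝ, 0 < a → a ≤ b → AbsolutelyContinuousOnInterval u a b
  deriv_mem : ∀ᵐ t ∂(volume.restrict (Ioi (0 : ℝ))),
    ∃ w : Lp ℝ 2 m, HasDerivAt u w t ∧ -w ∈ cheegerSubdifferential m (u t)

/-- `P` is the heat semigroup on `L¹(X, m)`: the continuous extension to `L¹` of the
`L²` gradient flow of the Cheeger energy, restricted to initial data in `L¹ ∩ L²`. -/
structure IsL1HeatSemigroup {X : Type*} [MetricSpace X] [MeasurableSpace X] (m : Measure X)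
    (P : ℝ≥0 → Lp ℝ 1 m → Lp ℝ 1 m) : Prop where
  eq_flow : ∀ (f : Lp ℝ 1 m) (f' : Lp ℝ 2 m), f =ᵐ[m] f' →
    ∃ u : ℝ → Lp ℝ 2 m, IsL2HeatFlow m f' u ∧ ∀ t : ℝ≥0, P t f =ᵐ[m] u t
  continuous : ∀ t, Continuous (P t)

/-- The `p`-Hellinger–Kakutani distance of the measures `f m` and `g m` (for `f, g ≥ 0`),
`He_p(f, g) = (∫ |f^{1/p} - g^{1/p}|^p dm)^{1/p}`. -/
def hellinger {X : Type*} [MeasurableSpace X] (m : Measure X) (p : ℝ) (f g : X → ℝ) : ℝ≥0∞ :=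
  (∫⁻ x, ENNReal.ofReal (|f x ^ (1 / p) - g x ^ (1 / p)| ^ p) ∂m) ^ (1 / p)

end HeatHellinger

end

/-! The flow need not be linear, so no kernel or Jensen argument is available. The contraction rests
on an exchange inequality instead: if `ψ 0 = 0` and `0 ≤ ψ' ≤ 1`, replacing the pair `f, g` by `f -
ψ(f - g), g + ψ(f - g)` does not increase the sum of the Cheeger energies
(`cheeger_contraction_add_le`). With `c = ψ'(f - g)`, the two new slopes are at most `(1 - c)|Df| +
c|Dg|` and `c|Df| + (1 - c)|Dg|`; convexity of the square and summation do the rest.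

Tested against subgradients, this says that `∫ Ψ(u_t - v_t)` decreases along two flows whenever `Ψ'
= ψ` (`integral_heatFlow_sub_le`). The choice `Ψ(s) = s² / 2` gives uniqueness, and smoothed
positive parts give `∫ (u_t - v_t)₊ ≤ ∫ (f - g)₊`. Since `Ch` is 2-homogeneous, the flow commutes
with multiplication by `c > 0`, whence `∫ (P_t f - c P_t g)₊ ≤ ∫ (f - c g)₊` for every `c > 0`.

For `p > 1` the Hellinger integrand is a superposition of such terms: if `a > b ≥ 0`, then `(a^{1/p}
- b^{1/p})^p = ∫₀¹ (a - λ(r) b)₊ dr` with weights `λ(r) ≥ 1` (`lintegral_hellingerWeight`). Tonelli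
then yields the theorem; for `p = 1` the choice `c = 1` suffices.

Existence is Hilbert space theory. `Ch` is convex, lower semicontinuous and densely finite, so
implicit Euler schemes converge to a gradient flow. The flow is an `L¹` contraction on `L¹ ∩ L²`,
which is dense in `L¹`, and so it extends uniquely. -/

noncomputable section

namespace HeatHellinger

/-! ### Resolvents of a convex energy and estimates for implicit Euler steps -/

section GradientFlow

variable {H : Type*} [NormedAddCommGroup H] [InnerProductSpace ℝ H]

/-- A convex, lower semicontinuous, densely finite functional with minimum value `Φ 0 = 0`. -/
structure IsConvexEnergy (Φ : H → ℝ≥0∞) : Prop where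
  convex : ∀ (x y : H) (s : ℝ), 0 ≤ s → s ≤ 1 →
    Φ ((1 - s) • x + s • y) ≤ ENNReal.ofReal (1 - s) * Φ x + ENNReal.ofReal s * Φ y
  lsc : LowerSemicontinuous Φ
  zero : Φ 0 = 0
  dense : Dense {x | Φ x ≠ ∞}

/-- The subdifferential of a functional on a Hilbert space. -/
def subdiff (Φ : H → ℝ≥0∞) (f : H) : Set H :=
  {l | Φ f ≠ ∞ ∧ ∀ g : H, Φ g ≠ ∞ → inner ℝ l (g - f) ≤ (Φ g).toReal - (Φ f).toReal}

lemma subdiff_monotone {Φ : H → ℝ≥0∞} {f g l k : H} (hl : l ∈ subdiff Φ f)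
    (hk : k ∈ subdiff Φ g) : 0 ≤ inner ℝ (l - k) (f - g) := by
  have h1 := hl.2 g hk.1
  have h2 := hk.2 f hl.1
  rw [← neg_sub f g, inner_neg_right] at h1
  rw [inner_sub_left]
  linarith

namespace IsConvexEnergy

variable {Φ : H → ℝ≥0∞} (hΦ : IsConvexEnergy Φ)
include hΦ

lemma finite_comb {x y : H} (hx : Φ x ≠ ∞) (hy : Φ y ≠ ∞) {s : ℝ} (h0 : 0 ≤ s) (h1 : s ≤ 1) :
    Φ ((1 - s) • x + s • y) ≠ ∞ ∧
      (Φ ((1 - s) • x + s • y)).toReal ≤ (1 - s) * (Φ x).toReal + s * (Φ y).toReal := by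
  have h := hΦ.convex x y s h0 h1
  have hfin : ENNReal.ofReal (1 - s) * Φ x + ENNReal.ofReal s * Φ y ≠ ∞ := by finiteness
  refine ⟨ne_top_of_le_ne_top hfin h, ?_⟩
  have := ENNReal.toReal_mono hfin h
  rwa [ENNReal.toReal_add (by finiteness) (by finiteness), ENNReal.toReal_mul,
    ENNReal.toReal_mul, ENNReal.toReal_ofReal (by linarith), ENNReal.toReal_ofReal h0] at this

lemma toReal_le_of_tendsto {x : ℕ → H} {y : H} {c : ℕ → ℝ} {C : ℝ}
    (hx : Tendsto x atTop (𝓝 y)) (hc : Tendsto c atTop (𝓝 C))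
    (h : ∀ᶠ n in atTop, Φ (x n) ≠ ∞ ∧ (Φ (x n)).toReal ≤ c n) :
    Φ y ≠ ∞ ∧ (Φ y).toReal ≤ C := by
  have hC : 0 ≤ C := ge_of_tendsto hc (h.mono fun n hn => ENNReal.toReal_nonneg.trans hn.2)
  have key : Φ y ≤ ENNReal.ofReal C := by
    by_contra! hlt
    obtain ⟨b, hb1, hb2⟩ := exists_between hlt
    have e1 := hx.eventually (hΦ.lsc y b hb2)
    have e2 := (ENNReal.tendsto_ofReal hc).eventually (gt_mem_nhds hb1)
    obtain ⟨n, hn1, hn2, hn3⟩ := (e1.and (e2.and h)).exists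
    have : Φ (x n) ≤ ENNReal.ofReal (c n) := by
      rw [← ENNReal.ofReal_toReal hn3.1]; exact ENNReal.ofReal_le_ofReal hn3.2
    exact absurd (hn1.trans_le this) (not_lt.2 hn2.le)
  exact ⟨ne_top_of_le_ne_top ENNReal.ofReal_ne_top key,
    ENNReal.toReal_le_of_le_ofReal hC key⟩

/-- Direct method: the resolvent minimises `Φ y + ‖y - x‖² / (2τ)`. Strong convexity makes
minimising sequences Cauchy, so no weak compactness is needed. -/
lemma exists_resolvent [CompleteSpace H] {τ : ℝ} (hτ : 0 < τ) (x : H) :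
    ∃ y, τ⁻¹ • (x - y) ∈ subdiff Φ y := by
  let F : H → ℝ := fun y => (Φ y).toReal + (2 * τ)⁻¹ * ‖y - x‖ ^ 2
  let D : Set H := {y | Φ y ≠ ∞}
  have hF0 : ∀ y, 0 ≤ F y := fun y => by positivity
  have hbdd : BddBelow (F '' D) := ⟨0, by rintro _ ⟨y, -, rfl⟩; exact hF0 y⟩
  have hne : (F '' D).Nonempty := ⟨_, 0, by simp [D, hΦ.zero], rfl⟩
  set I := sInf (F '' D) with hI
  have hIle : ∀ y ∈ D, I ≤ F y := fun y hy => csInf_le hbdd ⟨y, hy, rfl⟩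
  -- The parallelogram law at the midpoint of `a` and `b` bounds their distance by how far they are
  -- from minimising.
  have hmid : ∀ a ∈ D, ∀ b ∈ D, ‖a - b‖ ^ 2 ≤ 8 * τ * ((F a + F b) / 2 - I) := by
    intro a ha b hb
    obtain ⟨h1, h2⟩ := hΦ.finite_comb ha hb (s := 1 / 2) (by norm_num) (by norm_num)
    have h3 := hIle _ h1
    have hp := parallelogram_law_with_norm ℝ (a - x) (b - x)
    have e1 : (a - x) + (b - x) = (2 : ℝ) • (((1 - 1 / 2 : ℝ) • a + (1 / 2 : ℝ) • b) - x) := by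
      module
    have e2 : (a - x) - (b - x) = a - b := by abel
    rw [e1, e2, norm_smul] at hp
    simp only [Real.norm_ofNat] at hp
    have h4 : I ≤ (1 - 1 / 2) * (Φ a).toReal + 1 / 2 * (Φ b).toReal +
        (2 * τ)⁻¹ * ‖((1 - 1 / 2 : ℝ) • a + (1 / 2 : ℝ) • b) - x‖ ^ 2 := by
      simp only [F] at h3; linarith
    simp only [F]
    set N := ‖((1 - 1 / 2 : ℝ) • a + (1 / 2 : ℝ) • b) - x‖
    have h5 : N ^ 2 = (2 * (‖a - x‖ ^ 2 + ‖b - x‖ ^ 2) - ‖a - b‖ ^ 2) / 4 := by linarith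
    rw [h5] at h4
    have : (2 * τ)⁻¹ * (‖a - b‖ ^ 2 / 4) ≤ ((Φ a).toReal + (2 * τ)⁻¹ * ‖a - x‖ ^ 2 +
      ((Φ b).toReal + (2 * τ)⁻¹ * ‖b - x‖ ^ 2)) / 2 - I := by linarith
    calc ‖a - b‖ ^ 2 = 8 * τ * ((2 * τ)⁻¹ * (‖a - b‖ ^ 2 / 4)) := by field_simp; ring
      _ ≤ _ := by gcongr
  have hseq : ∀ n : ℕ, ∃ y ∈ D, F y < I + 1 / (n + 1) := fun n => by
    obtain ⟨_, ⟨y, hy, rfl⟩, h⟩ := exists_lt_of_csInf_lt hne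
      (show sInf (F '' D) < I + 1 / ((n : ℝ) + 1) by rw [← hI]; simp; positivity)
    exact ⟨y, hy, h⟩
  choose y hyD hyF using hseq
  have hcau : CauchySeq y := by
    rw [Metric.cauchySeq_iff']
    intro ε hε
    obtain ⟨N, hN⟩ := exists_nat_one_div_lt (show 0 < ε ^ 2 / (8 * τ) by positivity)
    refine ⟨N, fun n hn => ?_⟩
    have h1 := hmid _ (hyD n) _ (hyD N)
    have h2 : 1 / ((n : ℝ) + 1) ≤ 1 / ((N : ℝ) + 1) := by gcongr
    have h3 : ((F (y n) + F (y N)) / 2 - I) < ε ^ 2 / (8 * τ) := by linarith [hyF n, hyF N]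
    rw [dist_eq_norm]
    have h4 : ‖y n - y N‖ ^ 2 < ε ^ 2 := by
      calc _ ≤ _ := h1
        _ < 8 * τ * (ε ^ 2 / (8 * τ)) := by gcongr
        _ = _ := by field_simp
    exact lt_of_pow_lt_pow_left₀ 2 hε.le h4
  obtain ⟨z, hz⟩ := cauchySeq_tendsto_of_complete hcau
  obtain ⟨hzD, hzF⟩ := hΦ.toReal_le_of_tendsto hz
    (c := fun n => I + 1 / ((n : ℝ) + 1) - (2 * τ)⁻¹ * ‖y n - x‖ ^ 2)
    (C := I + 0 - (2 * τ)⁻¹ * ‖z - x‖ ^ 2)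
    ((tendsto_const_nhds.add tendsto_one_div_add_atTop_nhds_zero_nat).sub
      (((hz.sub_const x).norm.pow 2).const_mul _))
    (Eventually.of_forall fun n => ⟨hyD n, by have := hyF n; simp only [F] at this; linarith⟩)
  refine ⟨z, hzD, fun g hg => ?_⟩
  -- Optimality of `z` against the segment towards `g`, divided by `s`; the quadratic error
  -- disappears as `s → 0`.
  have hs : ∀ s ∈ Ioo (0 : ℝ) 1, 0 ≤ (Φ g).toReal - (Φ z).toReal - inner ℝ (τ⁻¹ • (x - z)) (g - z)
      + s * ((2 * τ)⁻¹ * ‖g - z‖ ^ 2) := by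
    intro s ⟨hs0, hs1⟩
    obtain ⟨h1, h2⟩ := hΦ.finite_comb hzD hg hs0.le hs1.le
    have h3 := hIle _ h1
    simp only [F] at h3
    have e : ((1 - s) • z + s • g) - x = (z - x) + s • (g - z) := by module
    rw [e, norm_add_sq_real, norm_smul, Real.norm_of_nonneg hs0.le, inner_smul_right] at h3
    have e2 : inner ℝ (τ⁻¹ • (x - z)) (g - z) = - (τ⁻¹ * inner ℝ (z - x) (g - z)) := by
      rw [inner_smul_left, ← neg_sub z x, inner_neg_left]; simp
    rw [e2]
    have e3 : (2 * τ)⁻¹ * (‖z - x‖ ^ 2 + 2 * (s * inner ℝ (z - x) (g - z)) + (s * ‖g - z‖) ^ 2)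
      = (2 * τ)⁻¹ * ‖z - x‖ ^ 2 + s * (τ⁻¹ * inner ℝ (z - x) (g - z))
        + s * (s * ((2 * τ)⁻¹ * ‖g - z‖ ^ 2)) := by field_simp
    rw [e3] at h3
    have : 0 ≤ s * ((Φ g).toReal - (Φ z).toReal - -(τ⁻¹ * inner ℝ (z - x) (g - z))
      + s * ((2 * τ)⁻¹ * ‖g - z‖ ^ 2)) := by nlinarith
    exact nonneg_of_mul_nonneg_right this hs0
  have hlim : Tendsto (fun s : ℝ => (Φ g).toReal - (Φ z).toReal -
      inner ℝ (τ⁻¹ • (x - z)) (g - z) + s * ((2 * τ)⁻¹ * ‖g - z‖ ^ 2)) (𝓝[>] 0)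
      (𝓝 ((Φ g).toReal - (Φ z).toReal - inner ℝ (τ⁻¹ • (x - z)) (g - z)
        + 0 * ((2 * τ)⁻¹ * ‖g - z‖ ^ 2))) :=
    ((tendsto_nhdsWithin_of_tendsto_nhds tendsto_id).mul_const _).const_add _
  have := ge_of_tendsto hlim (Filter.eventually_of_mem (Ioo_mem_nhdsGT one_pos) hs)
  linarith

end IsConvexEnergy

/-- The resolvent (implicit Euler step of size `τ`) of an energy. -/
def resolvent (Φ : H → ℝ≥0∞) (τ : ℝ) (x : H) : H :=
  Classical.epsilon fun y => τ⁻¹ • (x - y) ∈ subdiff Φ y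

namespace IsConvexEnergy

variable [CompleteSpace H] {Φ : H → ℝ≥0∞} (hΦ : IsConvexEnergy Φ) {τ : ℝ} (hτ : 0 < τ)
include hΦ hτ

lemma resolvent_mem (x : H) :
    τ⁻¹ • (x - resolvent Φ τ x) ∈ subdiff Φ (resolvent Φ τ x) :=
  Classical.epsilon_spec (hΦ.exists_resolvent hτ x)

lemma norm_resolvent_sub_le (x y : H) :
    ‖resolvent Φ τ x - resolvent Φ τ y‖ ≤ ‖x - y‖ := by
  have h := subdiff_monotone (hΦ.resolvent_mem hτ x) (hΦ.resolvent_mem hτ y)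
  set a := resolvent Φ τ x
  set b := resolvent Φ τ y
  have e : τ⁻¹ • (x - a) - τ⁻¹ • (y - b) = τ⁻¹ • ((x - y) - (a - b)) := by module
  rw [e, inner_smul_left, inner_sub_left, real_inner_self_eq_norm_sq] at h
  simp only [map_inv₀, conj_trivial] at h
  have h1 := nonneg_of_mul_nonneg_right h (inv_pos.2 hτ)
  have h2 := real_inner_le_norm (x - y) (a - b)
  by_contra! hlt
  have : 0 < ‖a - b‖ := (norm_nonneg _).trans_lt hlt
  nlinarith

lemma norm_iterate_sub_le (n : ℕ) (x y : H) :
    ‖(resolvent Φ τ)^[n] x - (resolvent Φ τ)^[n] y‖ ≤ ‖x - y‖ := by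
  induction n with
  | zero => simp
  | succ n ih =>
    rw [Function.iterate_succ_apply', Function.iterate_succ_apply']
    exact (hΦ.norm_resolvent_sub_le hτ _ _).trans ih

lemma norm_resolvent_sub_self_le {x l : H} (hl : l ∈ subdiff Φ x) :
    ‖resolvent Φ τ x - x‖ ≤ τ * ‖l‖ := by
  have h := subdiff_monotone (hΦ.resolvent_mem hτ x) hl
  set a := resolvent Φ τ x
  have e : τ⁻¹ • (x - a) - l = τ⁻¹ • (- τ • l - (a - x)) := by
    have : τ⁻¹ • (-τ • l) = -l := by rw [smul_smul, mul_neg, inv_mul_cancel₀ hτ.ne', neg_one_smul]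
    rw [smul_sub τ⁻¹ (-τ • l), this]; module
  rw [e, inner_smul_left, inner_sub_left, real_inner_self_eq_norm_sq] at h
  simp only [map_inv₀, conj_trivial] at h
  have h1 := nonneg_of_mul_nonneg_right h (inv_pos.2 hτ)
  have h2 := real_inner_le_norm (-τ • l) (a - x)
  rw [norm_smul, norm_neg, Real.norm_of_nonneg hτ.le] at h2
  by_contra! hlt
  have : 0 < ‖a - x‖ := lt_of_le_of_lt (by positivity) hlt
  nlinarith

lemma norm_iterate_sub_self_le {x l : H} (hl : l ∈ subdiff Φ x) (n : ℕ) :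
    ‖(resolvent Φ τ)^[n] x - x‖ ≤ n * τ * ‖l‖ := by
  induction n with
  | zero => simp
  | succ n ih =>
    rw [Function.iterate_succ_apply]
    calc _ = ‖((resolvent Φ τ)^[n] (resolvent Φ τ x) - (resolvent Φ τ)^[n] x) +
          ((resolvent Φ τ)^[n] x - x)‖ := by congr 1; abel
      _ ≤ τ * ‖l‖ + n * τ * ‖l‖ := (norm_add_le _ _).trans (add_le_add
          ((hΦ.norm_iterate_sub_le hτ _ _ _).trans (hΦ.norm_resolvent_sub_self_le hτ hl)) ih)
      _ = _ := by push_cast; ring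

/-- Monotonicity of the subdifferential, multiplied by `τ * μ`, followed by Cauchy–Schwarz and
Young. This is the recursion behind the comparison of schemes with different steps. -/
lemma sq_norm_resolvent_sub_resolvent_le {μ : ℝ} (hμ : 0 < μ) (x y : H) :
    (τ + μ) * ‖resolvent Φ τ x - resolvent Φ μ y‖ ^ 2 ≤
      μ * ‖x - resolvent Φ μ y‖ ^ 2 + τ * ‖resolvent Φ τ x - y‖ ^ 2 := by
  have h := subdiff_monotone (hΦ.resolvent_mem hτ x) (hΦ.resolvent_mem hμ y)
  set a := resolvent Φ τ x
  set b := resolvent Φ μ y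
  have e : τ⁻¹ • (x - a) - μ⁻¹ • (y - b) =
      τ⁻¹ • ((x - b) - (a - b)) + μ⁻¹ • ((a - y) - (a - b)) := by module
  rw [e, inner_add_left, inner_smul_left, inner_smul_left, inner_sub_left (x - b),
    inner_sub_left (a - y), real_inner_self_eq_norm_sq] at h
  simp only [map_inv₀, conj_trivial] at h
  have h1 : 0 ≤ μ * (inner ℝ (x - b) (a - b) - ‖a - b‖ ^ 2) +
      τ * (inner ℝ (a - y) (a - b) - ‖a - b‖ ^ 2) := by
    have := mul_nonneg (mul_pos hτ hμ).le h
    calc _ ≤ _ := this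
      _ = _ := by field_simp
  have h2 := real_inner_le_norm (x - b) (a - b)
  have h3 := real_inner_le_norm (a - y) (a - b)
  nlinarith [mul_nonneg hμ.le (sq_nonneg (‖x - b‖ - ‖a - b‖)),
    mul_nonneg hτ.le (sq_nonneg (‖a - y‖ - ‖a - b‖)), mul_le_mul_of_nonneg_left h2 hμ.le,
    mul_le_mul_of_nonneg_left h3 hτ.le]

/-- Comparison of two implicit Euler schemes with different step sizes. -/
lemma sq_norm_iterate_sub_iterate_le {μ : ℝ} (hμ : 0 < μ) {x l : H} (hl : l ∈ subdiff Φ x)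
    (m n : ℕ) :
    ‖(resolvent Φ τ)^[m] x - (resolvent Φ μ)^[n] x‖ ^ 2 ≤
      ‖l‖ ^ 2 * ((m * τ - n * μ) ^ 2 + m * τ ^ 2 + n * μ ^ 2) := by
  induction m generalizing n with
  | zero =>
    have h := hΦ.norm_iterate_sub_self_le hμ hl n
    rw [Function.iterate_zero_apply, norm_sub_rev]
    calc _ ≤ (n * μ * ‖l‖) ^ 2 := by gcongr
      _ ≤ _ := by
        have : 0 ≤ ‖l‖ ^ 2 * (n * μ ^ 2) := by positivity
        simp only [Nat.cast_zero]; nlinarith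
  | succ m ihm =>
    induction n with
    | zero =>
      have h := hΦ.norm_iterate_sub_self_le hτ hl (m + 1)
      rw [Function.iterate_zero_apply]
      calc _ ≤ ((m + 1 : ℕ) * τ * ‖l‖) ^ 2 := by gcongr
        _ ≤ _ := by
          have : 0 ≤ ‖l‖ ^ 2 * ((m + 1 : ℕ) * τ ^ 2) := by positivity
          simp only [Nat.cast_zero]; nlinarith
    | succ n ihn =>
      have h := hΦ.sq_norm_resolvent_sub_resolvent_le hτ hμ ((resolvent Φ τ)^[m] x)
        ((resolvent Φ μ)^[n] x)
      have i1 := ihm (n + 1)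
      rw [Function.iterate_succ_apply'] at i1
      rw [Function.iterate_succ_apply'] at ihn
      rw [Function.iterate_succ_apply', Function.iterate_succ_apply']
      have hpos : 0 < τ + μ := by positivity
      refine le_of_mul_le_mul_left (h.trans ?_) hpos
      -- The claimed bound `B(m, n)` solves the recursion exactly: `(τ + μ) B(m+1, n+1) = μ B(m,
      -- n+1) + τ B(m+1, n)`.
      calc _ ≤ μ * (‖l‖ ^ 2 * ((m * τ - (n + 1 : ℕ) * μ) ^ 2 + m * τ ^ 2 + (n + 1 : ℕ) * μ ^ 2)) +
            τ * (‖l‖ ^ 2 * (((m + 1 : ℕ) * τ - n * μ) ^ 2 + (m + 1 : ℕ) * τ ^ 2 + n * μ ^ 2)) := by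
              gcongr
        _ = _ := by push_cast; ring

lemma energy_resolvent_ne_top (x : H) : Φ (resolvent Φ τ x) ≠ ∞ := (hΦ.resolvent_mem hτ x).1

/-- Testing the subgradient at the starting point gives the factor `τ⁻¹`, twice what comparing
values of the minimised functional gives. `lyapunov_iterate` uses the full factor. -/
lemma energy_resolvent_add_le {x : H} (hx : Φ x ≠ ∞) :
    (Φ (resolvent Φ τ x)).toReal + τ⁻¹ * ‖resolvent Φ τ x - x‖ ^ 2 ≤ (Φ x).toReal := by
  have h := (hΦ.resolvent_mem hτ x).2 x hx
  rw [inner_smul_left, real_inner_self_eq_norm_sq, norm_sub_rev] at h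
  simp only [map_inv₀, conj_trivial] at h
  linarith

/-- One-step evolution variational inequality: the subgradient inequality at `v`, with `‖x - v‖²`
expanded around the resolvent and the term `‖x - a‖²` dropped. -/
lemma sq_norm_resolvent_sub_le (x : H) {v : H} (hv : Φ v ≠ ∞) :
    ‖resolvent Φ τ x - v‖ ^ 2 / 2 - ‖x - v‖ ^ 2 / 2 ≤
      τ * ((Φ v).toReal - (Φ (resolvent Φ τ x)).toReal) := by
  have h := (hΦ.resolvent_mem hτ x).2 v hv
  set a := resolvent Φ τ x
  have h1 := mul_le_mul_of_nonneg_left h hτ.le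
  rw [inner_smul_left] at h1
  simp only [map_inv₀, conj_trivial] at h1
  rw [← mul_assoc, mul_inv_cancel₀ hτ.ne', one_mul] at h1
  have e : x - v = (x - a) + (a - v) := by abel
  rw [← neg_sub a v, inner_neg_right] at h1
  rw [e, norm_add_sq_real]
  nlinarith [sq_nonneg ‖x - a‖]

/-- The start is excluded by `1 ≤ m`: there `Φ` may be `∞`, and `toReal` would then read `0`. -/
lemma energy_iterate_antitone {x : H} {m n : ℕ} (hmn : m ≤ n) (hm : 1 ≤ m) :
    (Φ ((resolvent Φ τ)^[n] x)).toReal ≤ (Φ ((resolvent Φ τ)^[m] x)).toReal := by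
  induction n, hmn using Nat.le_induction with
  | base => rfl
  | succ n hn ih =>
    refine le_trans ?_ ih
    obtain ⟨k, rfl⟩ : ∃ k, n = k + 1 := ⟨n - 1, by omega⟩
    rw [Function.iterate_succ_apply' _ (k + 1)]
    have h := hΦ.energy_resolvent_add_le hτ (x := (resolvent Φ τ)^[k + 1] x)
      (by rw [Function.iterate_succ_apply']; exact hΦ.energy_resolvent_ne_top hτ _)
    have : 0 ≤ τ⁻¹ * ‖resolvent Φ τ ((resolvent Φ τ)^[k + 1] x) - (resolvent Φ τ)^[k + 1] x‖ ^ 2 := by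
      positivity
    linarith

/-- Discrete evolution variational inequality. -/
lemma sq_norm_iterate_sub_le (x : H) {v : H} (hv : Φ v ≠ ∞) {m n : ℕ} (hmn : m ≤ n) :
    ‖(resolvent Φ τ)^[n] x - v‖ ^ 2 / 2 - ‖(resolvent Φ τ)^[m] x - v‖ ^ 2 / 2 ≤
      (n - m) * τ * ((Φ v).toReal - (Φ ((resolvent Φ τ)^[n] x)).toReal) := by
  induction n, hmn using Nat.le_induction with
  | base => simp
  | succ n hn ih =>
    have h1 := hΦ.sq_norm_resolvent_sub_le hτ ((resolvent Φ τ)^[n] x) hv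
    rw [← Function.iterate_succ_apply' (resolvent Φ τ) n x] at h1
    rcases hn.eq_or_lt with rfl | hlt
    · push_cast; linarith
    · have h2 := hΦ.energy_iterate_antitone hτ (x := x) (Nat.le_succ n) (by omega)
      have h3 : (m : ℝ) ≤ n := by exact_mod_cast hn
      have h4 : 0 ≤ ((n : ℝ) - m) * τ := mul_nonneg (by linarith) hτ.le
      have h5 := mul_le_mul_of_nonneg_left h2 h4
      push_cast
      nlinarith

lemma norm_iterate_step_antitone (x : H) (n : ℕ) :
    ‖(resolvent Φ τ)^[n + 2] x - (resolvent Φ τ)^[n + 1] x‖ ≤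
      ‖(resolvent Φ τ)^[n + 1] x - (resolvent Φ τ)^[n] x‖ := by
  rw [Function.iterate_succ_apply' _ (n + 1), Function.iterate_succ_apply' _ n]
  exact hΦ.norm_resolvent_sub_le hτ _ _

/-- Discrete version of the decreasing quantity `‖u‖² / 2 + t Φ(u) + t² ‖u'‖² / 2`. It bounds the
speed by `‖x‖ / t` for arbitrary starting points, including those of infinite energy. -/
lemma lyapunov_iterate (x : H) (n : ℕ) :
    ‖(resolvent Φ τ)^[n + 1] x‖ ^ 2 / 2 + (n + 1) * τ * (Φ ((resolvent Φ τ)^[n + 1] x)).toReal +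
      (n + 1) * n / 2 * ‖(resolvent Φ τ)^[n + 1] x - (resolvent Φ τ)^[n] x‖ ^ 2 ≤ ‖x‖ ^ 2 / 2 := by
  have hz : Φ 0 ≠ ∞ := by simp [hΦ.zero]
  induction n with
  | zero =>
    have := hΦ.sq_norm_resolvent_sub_le hτ x hz
    simp only [sub_zero, hΦ.zero, ENNReal.toReal_zero] at this
    simp; linarith
  | succ n ih =>
    have h1 := hΦ.sq_norm_resolvent_sub_le hτ ((resolvent Φ τ)^[n + 1] x) hz
    have h2 := hΦ.energy_resolvent_add_le hτ (x := (resolvent Φ τ)^[n + 1] x)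
      (by rw [Function.iterate_succ_apply']; exact hΦ.energy_resolvent_ne_top hτ _)
    have h3 := hΦ.norm_iterate_step_antitone hτ x n
    rw [← Function.iterate_succ_apply' (resolvent Φ τ) (n + 1) x] at h1 h2
    simp only [sub_zero, hΦ.zero, ENNReal.toReal_zero] at h1
    have h4 : (n + 1) * τ * (Φ ((resolvent Φ τ)^[n + 1 + 1] x)).toReal + (n + 1) *
        ‖(resolvent Φ τ)^[n + 1 + 1] x - (resolvent Φ τ)^[n + 1] x‖ ^ 2 ≤
        (n + 1) * τ * (Φ ((resolvent Φ τ)^[n + 1] x)).toReal := by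
      have := mul_le_mul_of_nonneg_left h2 (show 0 ≤ ((n : ℝ) + 1) * τ by positivity)
      calc _ = _ := by field_simp
        _ ≤ _ := this
    have h5 : ((n : ℝ) + 1) * n / 2 * ‖(resolvent Φ τ)^[n + 2] x - (resolvent Φ τ)^[n + 1] x‖ ^ 2 ≤
      (n + 1) * n / 2 * ‖(resolvent Φ τ)^[n + 1] x - (resolvent Φ τ)^[n] x‖ ^ 2 := by gcongr
    push_cast
    nlinarith

lemma norm_iterate_step_le (x : H) (n : ℕ) :
    n * ‖(resolvent Φ τ)^[n + 1] x - (resolvent Φ τ)^[n] x‖ ≤ ‖x‖ := by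
  have h := hΦ.lyapunov_iterate hτ x n
  have h1 : 0 ≤ ((n : ℝ) + 1) * τ * (Φ ((resolvent Φ τ)^[n + 1] x)).toReal := by positivity
  have h2 : 0 ≤ ‖(resolvent Φ τ)^[n + 1] x‖ ^ 2 / 2 := by positivity
  set d := ‖(resolvent Φ τ)^[n + 1] x - (resolvent Φ τ)^[n] x‖
  refine le_of_sq_le_sq ?_ (norm_nonneg x)
  have : 0 ≤ (n : ℝ) * d ^ 2 := by positivity
  nlinarith

lemma norm_iterate_sub_iterate_le (x : H) {m n : ℕ} (hmn : m ≤ n) :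
    m * ‖(resolvent Φ τ)^[n] x - (resolvent Φ τ)^[m] x‖ ≤ (n - m) * ‖x‖ := by
  induction n, hmn using Nat.le_induction with
  | base => simp
  | succ n hn ih =>
    have h1 := hΦ.norm_iterate_step_le hτ x n
    have h2 : ‖(resolvent Φ τ)^[n + 1] x - (resolvent Φ τ)^[m] x‖ ≤
      ‖(resolvent Φ τ)^[n + 1] x - (resolvent Φ τ)^[n] x‖ +
      ‖(resolvent Φ τ)^[n] x - (resolvent Φ τ)^[m] x‖ := norm_sub_le_norm_sub_add_norm_sub _ _ _
    have h3 : (m : ℝ) ≤ n := by exact_mod_cast hn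
    have h4 := mul_le_mul_of_nonneg_left h2 (Nat.cast_nonneg (α := ℝ) m)
    have h5 := mul_le_mul_of_nonneg_right h3
      (norm_nonneg ((resolvent Φ τ)^[n + 1] x - (resolvent Φ τ)^[n] x))
    push_cast
    linarith

end IsConvexEnergy

end GradientFlow

/-! ### Convergence of the Euler scheme and properties of the limit flow -/

section Semigroup

variable {H : Type*} [NormedAddCommGroup H] [InnerProductSpace ℝ H]

/-- The piecewise constant interpolation, at time `t`, of the implicit Euler scheme with step
`1 / (k + 1)`. -/
def eulerScheme (Φ : H → ℝ≥0∞) (k : ℕ) (t : ℝ) (x : H) : H :=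
  (resolvent Φ (1 / ((k : ℝ) + 1)))^[⌊t * ((k : ℝ) + 1)⌋₊] x

/-- The gradient flow semigroup of an energy, as the limit of the implicit Euler scheme. -/
def gradientFlow (Φ : H → ℝ≥0∞) (t : ℝ) (x : H) : H :=
  limUnder atTop fun k => eulerScheme Φ k t x

lemma tendsto_floor_mul_div (t : ℝ) (ht : 0 ≤ t) :
    Tendsto (fun k : ℕ => (⌊t * ((k : ℝ) + 1)⌋₊ : ℝ) * (1 / ((k : ℝ) + 1))) atTop (𝓝 t) := by
  have h := (tendsto_nat_floor_mul_div_atTop ht).comp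
    (tendsto_atTop_add_const_right atTop (1 : ℝ) tendsto_natCast_atTop_atTop)
  simpa [Function.comp_def, div_eq_mul_inv] using h

namespace IsConvexEnergy

variable [CompleteSpace H] {Φ : H → ℝ≥0∞} (hΦ : IsConvexEnergy Φ)
include hΦ

/-- Resolvents land in the domain of the subdifferential, and at a point `z` of finite energy `‖J_τ
z - z‖² ≤ τ Φ z → 0`. -/
lemma dense_subdiff_nonempty : Dense {x | (subdiff Φ x).Nonempty} := by
  have hsub : {x | Φ x ≠ ∞} ⊆ closure {x | (subdiff Φ x).Nonempty} := by
    intro z hz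
    refine mem_closure_of_tendsto
      (f := fun n : ℕ => resolvent Φ (1 / ((n : ℝ) + 1)) z) (b := atTop) ?_
      (Eventually.of_forall fun n => ⟨_, hΦ.resolvent_mem Nat.one_div_pos_of_nat z⟩)
    rw [tendsto_iff_norm_sub_tendsto_zero]
    have h : ∀ n : ℕ, ‖resolvent Φ (1 / ((n : ℝ) + 1)) z - z‖ ≤
        √(1 / ((n : ℝ) + 1) * (Φ z).toReal) := fun n => by
      have hτ : 0 < 1 / ((n : ℝ) + 1) := Nat.one_div_pos_of_nat
      have h := hΦ.energy_resolvent_add_le hτ hz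
      apply Real.le_sqrt_of_sq_le
      have h0 : 0 ≤ (Φ (resolvent Φ (1 / ((n : ℝ) + 1)) z)).toReal := ENNReal.toReal_nonneg
      have := mul_le_mul_of_nonneg_left
        (show (1 / ((n : ℝ) + 1))⁻¹ * ‖resolvent Φ (1 / ((n : ℝ) + 1)) z - z‖ ^ 2 ≤ (Φ z).toReal by
          linarith) hτ.le
      rwa [← mul_assoc, mul_inv_cancel₀ hτ.ne', one_mul] at this
    refine squeeze_zero (fun _ => norm_nonneg _) h ?_
    have := (tendsto_one_div_add_atTop_nhds_zero_nat (𝕜 := ℝ)).mul_const (Φ z).toReal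
    simpa using this.sqrt
  exact dense_closure.1 (hΦ.dense.mono hsub)

lemma norm_eulerScheme_sub_le (k : ℕ) (t : ℝ) (x y : H) :
    ‖eulerScheme Φ k t x - eulerScheme Φ k t y‖ ≤ ‖x - y‖ :=
  hΦ.norm_iterate_sub_le Nat.one_div_pos_of_nat _ _ _

lemma cauchySeq_eulerScheme_of_subdiff {t : ℝ} (ht : 0 ≤ t) {x l : H} (hl : l ∈ subdiff Φ x) :
    CauchySeq fun k => eulerScheme Φ k t x := by
  have hb : Tendsto (fun N : ℕ => √(‖l‖ ^ 2 * ((1 / ((N : ℝ) + 1)) ^ 2 +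
      2 * (t * (1 / ((N : ℝ) + 1)))))) atTop (𝓝 0) := by
    have h := tendsto_one_div_add_atTop_nhds_zero_nat (𝕜 := ℝ)
    have := (((h.pow 2).add ((h.const_mul t).const_mul 2)).const_mul (‖l‖ ^ 2)).sqrt
    simpa using this
  refine cauchySeq_of_le_tendsto_0 _ (fun m n N hm hn => ?_) hb
  rw [dist_eq_norm]
  have h := hΦ.sq_norm_iterate_sub_iterate_le (τ := 1 / ((m : ℝ) + 1)) Nat.one_div_pos_of_nat
    (μ := 1 / ((n : ℝ) + 1)) Nat.one_div_pos_of_nat hl ⌊t * ((m : ℝ) + 1)⌋₊ ⌊t * ((n : ℝ) + 1)⌋₊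
  refine Real.le_sqrt_of_sq_le (h.trans ?_)
  -- The elapsed time of scheme `j` falls short of `t` by at most one step, and its summed squared
  -- steps are at most `t` times the step.
  have key : ∀ j : ℕ, N ≤ j → 0 ≤ t - ⌊t * ((j : ℝ) + 1)⌋₊ * (1 / ((j : ℝ) + 1)) ∧
      t - ⌊t * ((j : ℝ) + 1)⌋₊ * (1 / ((j : ℝ) + 1)) ≤ 1 / ((N : ℝ) + 1) ∧
      ⌊t * ((j : ℝ) + 1)⌋₊ * (1 / ((j : ℝ) + 1)) ^ 2 ≤ t * (1 / ((N : ℝ) + 1)) := by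
    intro j hj
    have hjp : (0 : ℝ) < (j : ℝ) + 1 := by positivity
    have h1 := Nat.floor_le (show 0 ≤ t * ((j : ℝ) + 1) by positivity)
    have h2 := Nat.lt_floor_add_one (t * ((j : ℝ) + 1))
    have h3 : 1 / ((j : ℝ) + 1) ≤ 1 / ((N : ℝ) + 1) := by gcongr
    have h4 : ⌊t * ((j : ℝ) + 1)⌋₊ * (1 / ((j : ℝ) + 1)) ≤ t := by
      rw [mul_one_div, div_le_iff₀ hjp]; exact h1
    refine ⟨by linarith, ?_, ?_⟩
    · refine le_trans ?_ h3
      rw [mul_one_div, sub_le_iff_le_add, ← add_div, le_div_iff₀ hjp]; linarith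
    · calc _ = ⌊t * ((j : ℝ) + 1)⌋₊ * (1 / ((j : ℝ) + 1)) * (1 / ((j : ℝ) + 1)) := by ring
        _ ≤ t * (1 / ((N : ℝ) + 1)) := by gcongr
  obtain ⟨m1, m2, m3⟩ := key m hm
  obtain ⟨n1, n2, n3⟩ := key n hn
  have hsq : (⌊t * ((m : ℝ) + 1)⌋₊ * (1 / ((m : ℝ) + 1)) - ⌊t * ((n : ℝ) + 1)⌋₊ *
      (1 / ((n : ℝ) + 1))) ^ 2 ≤ (1 / ((N : ℝ) + 1)) ^ 2 := by
    apply sq_le_sq'  <;> linarith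
  gcongr ‖l‖ ^ 2 * ?_
  linarith

lemma cauchySeq_eulerScheme {t : ℝ} (ht : 0 ≤ t) (x : H) :
    CauchySeq fun k => eulerScheme Φ k t x := by
  rw [Metric.cauchySeq_iff]
  intro ε hε
  obtain ⟨y, ⟨l, hl⟩, hy⟩ := Metric.mem_closure_iff.1 (hΦ.dense_subdiff_nonempty x) (ε / 3)
    (by positivity)
  obtain ⟨N, hN⟩ := Metric.cauchySeq_iff.1 (hΦ.cauchySeq_eulerScheme_of_subdiff ht hl) (ε / 3)
    (by positivity)
  refine ⟨N, fun m hm n hn => ?_⟩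
  have h1 := hΦ.norm_eulerScheme_sub_le m t x y
  have h2 := hΦ.norm_eulerScheme_sub_le n t y x
  rw [← dist_eq_norm, ← dist_eq_norm] at h1 h2
  rw [dist_comm y x] at h2
  have h3 := dist_triangle4 (eulerScheme Φ m t x) (eulerScheme Φ m t y) (eulerScheme Φ n t y)
    (eulerScheme Φ n t x)
  linarith [hN m hm n hn]

lemma tendsto_eulerScheme {t : ℝ} (ht : 0 ≤ t) (x : H) :
    Tendsto (fun k => eulerScheme Φ k t x) atTop (𝓝 (gradientFlow Φ t x)) :=
  (hΦ.cauchySeq_eulerScheme ht x).tendsto_limUnder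

lemma gradientFlow_zero (x : H) : gradientFlow Φ 0 x = x :=
  tendsto_nhds_unique (hΦ.tendsto_eulerScheme le_rfl x)
    (tendsto_const_nhds.congr fun k => by simp [eulerScheme])

lemma norm_gradientFlow_sub_le {t : ℝ} (ht : 0 ≤ t) (x y : H) :
    ‖gradientFlow Φ t x - gradientFlow Φ t y‖ ≤ ‖x - y‖ :=
  le_of_tendsto ((hΦ.tendsto_eulerScheme ht x).sub (hΦ.tendsto_eulerScheme ht y)).norm
    (Eventually.of_forall fun k => hΦ.norm_eulerScheme_sub_le k t x y)

lemma norm_gradientFlow_sub_self_le {t : ℝ} (ht : 0 ≤ t) {x l : H} (hl : l ∈ subdiff Φ x) :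
    ‖gradientFlow Φ t x - x‖ ≤ t * ‖l‖ :=
  le_of_tendsto_of_tendsto ((hΦ.tendsto_eulerScheme ht x).sub_const x).norm
    ((tendsto_floor_mul_div t ht).mul_const ‖l‖)
    (Eventually.of_forall fun _ => hΦ.norm_iterate_sub_self_le Nat.one_div_pos_of_nat hl _)

lemma tendsto_gradientFlow_zero (x : H) :
    Tendsto (fun t => gradientFlow Φ t x) (𝓝[>] 0) (𝓝 x) := by
  rw [Metric.tendsto_nhds]
  intro ε hε
  obtain ⟨y, ⟨l, hl⟩, hy⟩ := Metric.mem_closure_iff.1 (hΦ.dense_subdiff_nonempty x) (ε / 3)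
    (by positivity)
  have hlim : Tendsto (fun t : ℝ => t * ‖l‖) (𝓝[>] 0) (𝓝 0) := by
    have : Tendsto (fun t : ℝ => t * ‖l‖) (𝓝 0) (𝓝 (0 * ‖l‖)) := tendsto_id.mul_const _
    rw [zero_mul] at this
    exact tendsto_nhdsWithin_of_tendsto_nhds this
  filter_upwards [hlim.eventually (gt_mem_nhds (show (0 : ℝ) < ε / 3 by positivity)),
    self_mem_nhdsWithin] with t h1 ht
  have h2 := hΦ.norm_gradientFlow_sub_le (le_of_lt ht) x y
  have h3 := hΦ.norm_gradientFlow_sub_self_le (le_of_lt ht) hl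
  rw [← dist_eq_norm, ← dist_eq_norm] at h2
  rw [← dist_eq_norm] at h3
  have h4 := dist_triangle4 (gradientFlow Φ t x) (gradientFlow Φ t y) y x
  rw [dist_comm y x] at h4
  linarith

/-- Smoothing effect: away from time `0` the flow is Lipschitz with a constant depending only on
`‖x‖`. Local absolute continuity and differentiability rest on this. -/
lemma norm_gradientFlow_sub_gradientFlow_le (x : H) {s t : ℝ} (hs : 0 < s) (hst : s ≤ t) :
    ‖gradientFlow Φ t x - gradientFlow Φ s x‖ ≤ ‖x‖ / s * (t - s) := by
  have ht : 0 ≤ t := hs.le.trans hst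
  have h : s * ‖gradientFlow Φ t x - gradientFlow Φ s x‖ ≤ (t - s) * ‖x‖ := by
    refine le_of_tendsto_of_tendsto ((tendsto_floor_mul_div s hs.le).mul
      ((hΦ.tendsto_eulerScheme ht x).sub (hΦ.tendsto_eulerScheme hs.le x)).norm)
      (((tendsto_floor_mul_div t ht).sub (tendsto_floor_mul_div s hs.le)).mul_const ‖x‖)
      (Eventually.of_forall fun k => ?_)
    have hk : 0 < 1 / ((k : ℝ) + 1) := Nat.one_div_pos_of_nat
    have := mul_le_mul_of_nonneg_left (hΦ.norm_iterate_sub_iterate_le hk x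
      (Nat.floor_mono (show s * ((k : ℝ) + 1) ≤ t * ((k : ℝ) + 1) by gcongr))) hk.le
    simp only [eulerScheme]
    linarith
  rw [div_mul_eq_mul_div, le_div_iff₀ hs]
  linarith

/-- Evolution variational inequality for the gradient flow. -/
lemma sq_norm_gradientFlow_sub_le (x : H) {s t : ℝ} (hs : 0 ≤ s) (hst : s < t) {v : H}
    (hv : Φ v ≠ ∞) :
    Φ (gradientFlow Φ t x) ≠ ∞ ∧
    ‖gradientFlow Φ t x - v‖ ^ 2 / 2 - ‖gradientFlow Φ s x - v‖ ^ 2 / 2 ≤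
      (t - s) * ((Φ v).toReal - (Φ (gradientFlow Φ t x)).toReal) := by
  have ht : 0 < t := hs.trans_lt hst
  have hT := hΦ.tendsto_eulerScheme ht.le x
  have hS := hΦ.tendsto_eulerScheme hs x
  have hfl := (tendsto_floor_mul_div t ht.le).sub (tendsto_floor_mul_div s hs)
  -- Dividing the discrete inequality by the elapsed time isolates the energy at time `t`, to which
  -- lower semicontinuity applies.
  have hN : Tendsto (fun k : ℕ => (Φ v).toReal - (‖eulerScheme Φ k t x - v‖ ^ 2 / 2 -
      ‖eulerScheme Φ k s x - v‖ ^ 2 / 2) / ((⌊t * ((k : ℝ) + 1)⌋₊ : ℝ) * (1 / ((k : ℝ) + 1)) -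
      (⌊s * ((k : ℝ) + 1)⌋₊ : ℝ) * (1 / ((k : ℝ) + 1)))) atTop (𝓝 ((Φ v).toReal -
      (‖gradientFlow Φ t x - v‖ ^ 2 / 2 - ‖gradientFlow Φ s x - v‖ ^ 2 / 2) / (t - s))) :=
    ((((hT.sub_const v).norm.pow 2).div_const 2).sub
      (((hS.sub_const v).norm.pow 2).div_const 2)).div hfl (sub_pos.2 hst).ne' |>.const_sub _
  obtain ⟨h1, h2⟩ := hΦ.toReal_le_of_tendsto hT hN (by
    filter_upwards [hfl.eventually (lt_mem_nhds (sub_pos.2 hst)),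
      (tendsto_floor_mul_div t ht.le).eventually (lt_mem_nhds ht)] with k hk hk2
    have hkp : 0 < 1 / ((k : ℝ) + 1) := Nat.one_div_pos_of_nat
    -- At least one Euler step has been taken, so the energy is finite even when `Φ x = ∞`.
    have hne : 1 ≤ ⌊t * ((k : ℝ) + 1)⌋₊ := by
      rw [Nat.one_le_iff_ne_zero]
      intro h0
      simp [h0] at hk2
    refine ⟨?_, ?_⟩
    · obtain ⟨n, hn⟩ : ∃ n, ⌊t * ((k : ℝ) + 1)⌋₊ = n + 1 := ⟨_, (Nat.sub_add_cancel hne).symm⟩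
      rw [eulerScheme, hn, Function.iterate_succ_apply']
      exact hΦ.energy_resolvent_ne_top hkp _
    · have := hΦ.sq_norm_iterate_sub_le hkp x hv
        (Nat.floor_mono (show s * ((k : ℝ) + 1) ≤ t * ((k : ℝ) + 1) by gcongr))
      rw [sub_mul] at this
      rw [le_sub_comm, div_le_iff₀ hk]
      simp only [eulerScheme]
      linarith)
  refine ⟨h1, ?_⟩
  rw [le_sub_comm, div_le_iff₀ (sub_pos.2 hst)] at h2
  linarith

/-- The variational inequality on `(s, t)` carries the energy at the later time `t`, so it is
divided by `t - s` and differentiated from the left. -/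
lemma neg_deriv_gradientFlow_mem {x w : H} {t : ℝ} (ht : 0 < t)
    (hw : HasDerivAt (fun t => gradientFlow Φ t x) w t) :
    -w ∈ subdiff Φ (gradientFlow Φ t x) := by
  refine ⟨(hΦ.sq_norm_gradientFlow_sub_le x le_rfl ht (v := 0) (by simp [hΦ.zero])).1,
    fun v hv => ?_⟩
  have hd : HasDerivAt (fun t => ‖gradientFlow Φ t x - v‖ ^ 2 / 2)
      (inner ℝ (gradientFlow Φ t x - v) w) t := by
    have := ((hw.sub_const v).norm_sq).div_const 2
    simpa using this
  have h1 := (hasDerivAt_iff_tendsto_slope_left_right.1 hd).1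
  have h2 : inner ℝ (gradientFlow Φ t x - v) w ≤
      (Φ v).toReal - (Φ (gradientFlow Φ t x)).toReal := by
    refine le_of_tendsto h1 ?_
    filter_upwards [Ioo_mem_nhdsLT ht] with s hs
    have h3 := (hΦ.sq_norm_gradientFlow_sub_le x hs.1.le hs.2 hv).2
    rw [slope_comm, slope_def_field, div_le_iff₀ (sub_pos.2 hs.2)]
    linarith
  rw [inner_neg_left, ← inner_neg_right, neg_sub, real_inner_comm]
  exact h2

end IsConvexEnergy

end Semigroup

/-! ### Almost everywhere differentiability of Lipschitz curves in a separable Hilbert space -/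

section AEDifferentiability

variable {H : Type*} [NormedAddCommGroup H] [InnerProductSpace ℝ H]

lemma lipschitzWith_inner_comp {f : ℝ → H} {K : ℝ≥0} (hf : LipschitzWith K f) (e : H) :
    LipschitzWith (‖e‖₊ * K) fun t => inner ℝ e (f t) :=
  LipschitzWith.of_dist_le_mul fun x y => by
    rw [Real.dist_eq, ← inner_sub_right]
    calc _ ≤ ‖e‖ * ‖f x - f y‖ := abs_real_inner_le_norm _ _
      _ ≤ ‖e‖ * (K * dist x y) := by
        gcongr; rw [← dist_eq_norm]; exact hf.dist_le_mul x y
      _ = _ := by push_cast; ring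

/-- A Lipschitz curve in a separable Hilbert space is differentiable almost everywhere. -/
theorem ae_differentiableAt_of_lipschitzWith [CompleteSpace H] [SecondCountableTopology H]
    {f : ℝ → H} {K : ℝ≥0} (hf : LipschitzWith K f) : ∀ᵐ t, DifferentiableAt ℝ f t := by
  let e : ℕ → H := TopologicalSpace.denseSeq H
  have he : DenseRange e := TopologicalSpace.denseRange_denseSeq H
  let φ : ℕ → ℝ → ℝ := fun k t => inner ℝ (e k) (f t)
  have hφ : ∀ k, LipschitzWith (‖e k‖₊ * K) (φ k) := fun k => lipschitzWith_inner_comp hf (e k)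
  have hφb : ∀ k t, |deriv (φ k) t| ≤ ‖e k‖ * K := fun k t => by
    have := norm_deriv_le_of_lipschitz (x₀ := t) (hφ k)
    simpa using this
  -- Derivatives in normalised directions; where `e k = 0` the quotient is `0`. Their supremum `M`
  -- plays the role of the metric speed.
  let q : ℕ → ℝ → ℝ := fun k t => deriv (φ k) t / ‖e k‖
  have hqb : ∀ k t, |q k t| ≤ K := fun k t => by
    rw [abs_div, abs_norm]
    exact div_le_of_le_mul₀ (norm_nonneg _) K.2 ((hφb k t).trans_eq (mul_comm _ _))
  let M : ℝ → ℝ := fun t => ⨆ k, q k t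
  have hbdd : ∀ t, BddAbove (range fun k => q k t) := fun t =>
    ⟨K, by rintro _ ⟨k, rfl⟩; exact (le_abs_self _).trans (hqb k t)⟩
  have hqM : ∀ k t, q k t ≤ M t := fun k t => le_ciSup (hbdd t) k
  have hMle : ∀ t, M t ≤ K := fun t => ciSup_le fun k => (le_abs_self _).trans (hqb k t)
  have hMb : ∀ t, ‖M t‖ ≤ K := fun t =>
    abs_le.2 ⟨(neg_le_of_abs_le (hqb 0 t)).trans (hqM 0 t), hMle t⟩
  have hMm : Measurable M := Measurable.iSup fun k => (measurable_deriv _).div_const _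
  have hMint : LocallyIntegrable M volume :=
    (locallyIntegrable_const (K : ℝ)).mono hMm.aestronglyMeasurable
      (Eventually.of_forall fun t => by simpa using hMb t)
  have hMii : ∀ a b, IntervalIntegrable M volume a b := fun a b =>
    intervalIntegrable_iff.mpr <|
      (hMint.integrableOn_isCompact isCompact_uIcc).mono_set uIoc_subset_uIcc
  have hdiff : ∀ s t, s ≤ t → ‖f t - f s‖ ≤ ∫ r in s..t, M r := by
    intro s t hst
    have h1 : ∀ v : H, inner ℝ v (f t - f s) ≤ ‖v‖ * ∫ r in s..t, M r := by
      refine fun v => he.induction_on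
        (p := fun v => inner ℝ v (f t - f s) ≤ ‖v‖ * ∫ r in s..t, M r) v
        (isClosed_le (by fun_prop) (by fun_prop)) fun k => ?_
      have hac : AbsolutelyContinuousOnInterval (φ k) s t :=
        ((hφ k).lipschitzOnWith).absolutelyContinuousOnInterval
      have h2 := hac.integral_deriv_eq_sub
      rw [inner_sub_right]
      change φ k t - φ k s ≤ _
      rw [← h2, ← intervalIntegral.integral_const_mul]
      refine intervalIntegral.integral_mono_on hst hac.intervalIntegrable_deriv
        ((hMii s t).const_mul _) fun r _ => ?_
      rcases (norm_nonneg (e k)).eq_or_lt with h0 | h0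
      · have := hφb k r
        rw [← h0] at this ⊢
        rw [zero_mul] at this ⊢
        exact (le_abs_self _).trans this
      · have := hqM k r
        rw [mul_comm]
        exact (div_le_iff₀ h0).1 this
    have h3 := h1 (f t - f s)
    rw [real_inner_self_eq_norm_sq] at h3
    rcases (norm_nonneg (f t - f s)).eq_or_lt with h0 | h0
    -- If the increment vanishes, what remains is `0 ≤ ∫ M`. Any nonzero direction gives it, and in
    -- the trivial space `M = 0`.
    · rw [← h0]
      by_cases hH : ∃ v : H, v ≠ 0
      · obtain ⟨v, hv⟩ := hH
        have h4 := h1 v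
        rw [norm_eq_zero.1 h0.symm, inner_zero_right] at h4
        exact nonneg_of_mul_nonneg_right h4 (norm_pos_iff.2 hv)
      · push Not at hH
        have : ∀ r, M r = 0 := fun r => by simp [M, q, hH (e _)]
        simp [this]
    · rw [pow_two] at h3
      exact le_of_mul_le_mul_left h3 h0
  let G : ℝ → ℝ := fun x => ∫ r in (0 : ℝ)..x, M r
  have hG : ∀ s t, G t - G s = ∫ r in s..t, M r := fun s t =>
    intervalIntegral.integral_interval_sub_left (hMii _ _) (hMii _ _)
  have hd : ∀ᵐ t, ∀ k, DifferentiableAt ℝ (φ k) t :=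
    ae_all_iff.2 fun k => (hφ k).ae_differentiableAt_real
  filter_upwards [LocallyIntegrable.ae_hasDerivAt_integral hMint, hd] with t ht1 ht2
  have hslG : Tendsto (_root_.slope G t) (𝓝[≠] t) (𝓝 (M t)) :=
    hasDerivAt_iff_tendsto_slope.1 (ht1 0)
  have hslφ : ∀ k, Tendsto (fun y => inner ℝ (e k) (_root_.slope f t y)) (𝓝[≠] t)
      (𝓝 (deriv (φ k) t)) := fun k => by
    refine (hasDerivAt_iff_tendsto_slope.1 (ht2 k).hasDerivAt).congr fun y => ?_
    simp [_root_.slope, φ, inner_smul_right, inner_sub_right]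
  have hnorm : ∀ y ≠ t, ‖_root_.slope f t y‖ ≤ _root_.slope G t y := by
    intro y hy
    rcases lt_or_gt_of_ne hy with h | h
    · rw [slope_comm f, slope_comm G, slope_def_field, slope_def_module, norm_smul, norm_inv,
        Real.norm_of_nonneg (sub_pos.2 h).le, hG, inv_mul_eq_div]
      have := hdiff y t h.le
      gcongr
    · rw [slope_def_field, slope_def_module, norm_smul, norm_inv,
        Real.norm_of_nonneg (sub_pos.2 h).le, hG, inv_mul_eq_div]
      have := hdiff t y h.le
      gcongr
  have hM0 : 0 ≤ M t := ge_of_tendsto hslG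
    (eventually_mem_nhdsWithin.mono fun y hy => (norm_nonneg _).trans (hnorm y hy))
  -- Difference quotients near `t` have norm below `M t + ε`, while their component along a nearly
  -- optimal `e k` exceeds `M t - ε`. Uniform convexity, via the parallelogram law, forces them
  -- together.
  have hcau : Cauchy (map (_root_.slope f t) (𝓝[≠] t)) := by
    rw [Metric.cauchy_iff]
    refine ⟨inferInstance, fun δ hδ => ?_⟩
    -- The constant comes from `4 (M + ε)² - 4 (M - ε)² = 16 M ε`.
    obtain ⟨ε, hε0, hε⟩ : ∃ ε > 0, 16 * (M t + ε) * ε < δ ^ 2 := by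
      have : Tendsto (fun ε : ℝ => 16 * (M t + ε) * ε) (𝓝[>] 0) (𝓝 0) := by
        have : Tendsto (fun ε : ℝ => 16 * (M t + ε) * ε) (𝓝 0) (𝓝 (16 * (M t + 0) * 0)) := by
          apply Continuous.tendsto; fun_prop
        rw [mul_zero] at this
        exact tendsto_nhdsWithin_of_tendsto_nhds this
      obtain ⟨ε, h1, h2⟩ := ((this.eventually (gt_mem_nhds (show 0 < δ ^ 2 by positivity))).and
        self_mem_nhdsWithin).exists
      exact ⟨ε, h2, h1⟩
    by_cases hMε : M t < ε
    · refine ⟨_, image_mem_map (inter_mem (hslG.eventually (gt_mem_nhds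
        (show M t < M t + ε by linarith))) self_mem_nhdsWithin), ?_⟩
      rintro _ ⟨y, ⟨hy1, hy2⟩, rfl⟩ _ ⟨z, ⟨hz1, hz2⟩, rfl⟩
      have h1 := (hnorm y hy2).trans_lt hy1
      have h2 := (hnorm z hz2).trans_lt hz1
      have h3 := norm_sub_le (_root_.slope f t y) (_root_.slope f t z)
      rw [dist_eq_norm]
      refine lt_of_pow_lt_pow_left₀ 2 hδ.le ?_
      have : ‖_root_.slope f t y - _root_.slope f t z‖ ^ 2 ≤ (2 * (M t + ε)) ^ 2 := by
        gcongr; linarith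
      nlinarith
    · push Not at hMε
      obtain ⟨k, hk⟩ := exists_lt_of_lt_ciSup (show M t - ε < ⨆ k, q k t by
        change M t - ε < M t; linarith)
      have hek : 0 < ‖e k‖ := by
        by_contra! h0
        have h0 : ‖e k‖ = 0 := le_antisymm h0 (norm_nonneg _)
        simp only [q, h0, div_zero] at hk
        linarith
      have hk' : ‖e k‖ * (M t - ε) < deriv (φ k) t := by
        rw [mul_comm]; exact (lt_div_iff₀ hek).1 hk
      refine ⟨_, image_mem_map (inter_mem (inter_mem (hslG.eventually (gt_mem_nhds
        (show M t < M t + ε by linarith))) ((hslφ k).eventually (lt_mem_nhds hk')))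
        self_mem_nhdsWithin), ?_⟩
      rintro _ ⟨y, ⟨⟨hy1, hy3⟩, hy2⟩, rfl⟩ _ ⟨z, ⟨⟨hz1, hz3⟩, hz2⟩, rfl⟩
      have h1 := (hnorm y hy2).trans_lt hy1
      have h2 := (hnorm z hz2).trans_lt hz1
      simp only [mem_ofPred_eq] at hy3 hz3
      set a := _root_.slope f t y
      set b := _root_.slope f t z
      have h3 : 2 * (M t - ε) ≤ ‖a + b‖ := by
        refine le_of_mul_le_mul_left ?_ hek
        have := real_inner_le_norm (e k) (a + b)
        rw [inner_add_right] at this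
        linarith
      have hp := parallelogram_law_with_norm ℝ a b
      have h4 : (2 * (M t - ε)) ^ 2 ≤ ‖a + b‖ ^ 2 := by gcongr
      have h5 : ‖a‖ ^ 2 ≤ (M t + ε) ^ 2 := by gcongr
      have h6 : ‖b‖ ^ 2 ≤ (M t + ε) ^ 2 := by gcongr
      rw [dist_eq_norm]
      refine lt_of_pow_lt_pow_left₀ 2 hδ.le ?_
      nlinarith
  obtain ⟨w, hw⟩ := CompleteSpace.complete hcau
  exact (hasDerivAt_iff_tendsto_slope.2 hw).differentiableAt

theorem ae_differentiableAt_gradientFlow [CompleteSpace H] [SecondCountableTopology H]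
    {Φ : H → ℝ≥0∞} (hΦ : IsConvexEnergy Φ) (x : H) :
    ∀ᵐ t ∂(volume.restrict (Ioi (0 : ℝ))), DifferentiableAt ℝ (fun t => gradientFlow Φ t x) t := by
  -- Freezing the flow before time `1 / (n + 1)` makes it globally Lipschitz; every `t > 0` lies
  -- beyond some freezing time.
  have h : ∀ n : ℕ, ∀ᵐ t : ℝ, DifferentiableAt ℝ
      (fun t => gradientFlow Φ (max (1 / ((n : ℝ) + 1)) t) x) t := fun n => by
    have hn : 0 < 1 / ((n : ℝ) + 1) := Nat.one_div_pos_of_nat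
    refine ae_differentiableAt_of_lipschitzWith (K := (‖x‖ / (1 / ((n : ℝ) + 1))).toNNReal)
      (LipschitzWith.of_dist_le_mul fun a b => ?_)
    rw [Real.coe_toNNReal _ (by positivity)]
    wlog hab : b ≤ a generalizing a b
    · rw [dist_comm, dist_comm a b]; exact this b a (le_of_not_ge hab)
    rw [dist_eq_norm, Real.dist_eq, abs_of_nonneg (sub_nonneg.2 hab)]
    have hmax : max (1 / ((n : ℝ) + 1)) a - max (1 / ((n : ℝ) + 1)) b ≤ a - b := by
      grind
    refine (hΦ.norm_gradientFlow_sub_gradientFlow_le x (lt_max_of_lt_left hn)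
      (max_le_max_left _ hab)).trans (mul_le_mul ?_ hmax
        (sub_nonneg.2 (max_le_max_left _ hab)) (by positivity))
    gcongr
    exact le_max_left _ _
  rw [ae_restrict_iff' measurableSet_Ioi]
  filter_upwards [ae_all_iff.2 h] with t ht ht0
  obtain ⟨n, hn⟩ := exists_nat_one_div_lt (show 0 < t from ht0)
  refine (ht n).congr_of_eventuallyEq ?_
  filter_upwards [lt_mem_nhds hn] with s hs
  rw [max_eq_right hs.le]

end AEDifferentiability

/-! ### Existence of the `L²` heat flow -/

section HeatFlowExistence

variable {X : Type*} [MetricSpace X] [MeasurableSpace X] {m : Measure X}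

theorem isL2HeatFlow_gradientFlow [SecondCountableTopology (Lp ℝ 2 m)]
    (hΦ : IsConvexEnergy (cheeger m)) (f : Lp ℝ 2 m) :
    IsL2HeatFlow m f fun t => gradientFlow (cheeger m) t f where
  initial := hΦ.gradientFlow_zero f
  tendsto_initial := hΦ.tendsto_gradientFlow_zero f
  absolutelyContinuous a b ha hab := by
    refine LipschitzOnWith.absolutelyContinuousOnInterval (K := (‖f‖ / a).toNNReal)
      (LipschitzOnWith.of_dist_le_mul fun s hs t ht => ?_)
    rw [uIcc_of_le hab] at hs ht
    rw [Real.coe_toNNReal _ (by positivity)]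
    wlog hst : t ≤ s generalizing s t
    · rw [dist_comm, dist_comm s t]; exact this t ht s hs (le_of_not_ge hst)
    rw [dist_eq_norm, Real.dist_eq, abs_of_nonneg (sub_nonneg.2 hst)]
    refine (hΦ.norm_gradientFlow_sub_gradientFlow_le f (ha.trans_le ht.1) hst).trans ?_
    gcongr
    exact ht.1
  deriv_mem := by
    filter_upwards [ae_differentiableAt_gradientFlow hΦ f, ae_restrict_mem measurableSet_Ioi]
      with t ht ht0
    exact ⟨_, ht.hasDerivAt, hΦ.neg_deriv_gradientFlow_mem ht0 ht.hasDerivAt⟩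

end HeatFlowExistence

/-! ### Measurability and first-order calculus of the slope -/

section Slope

variable {X : Type*} [MetricSpace X]

lemma slope_eq_iInf (f : X → ℝ) (x : X) :
    slope f x = ⨅ n : ℕ, ⨆ y, ⨆ _ : y ∈ Metric.ball x (1 / ((n : ℝ) + 1)) ∩ {x}ᶜ,
      edist (f y) (f x) / edist y x := by
  have h := (nhdsWithin_hasBasis (Metric.nhds_basis_ball_inv_nat_succ (x := x)) {x}ᶜ)
  rw [slope, h.limsup_eq_iInf_iSup]
  simp

/-- For fixed `y`, the conditions `y ∈ ball x r` and `y ≠ x` are open in `x` and the quotient is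
continuous there. The slope is a countable infimum of such functions, hence Borel. -/
lemma lowerSemicontinuous_iSup_quotient {f : X → ℝ} (hf : Continuous f) (r : ℝ) :
    LowerSemicontinuous fun x => ⨆ y, ⨆ _ : y ∈ Metric.ball x r ∩ {x}ᶜ,
      edist (f y) (f x) / edist y x := by
  refine lowerSemicontinuous_iSup fun y x c hc => ?_
  obtain ⟨⟨hy1, hy2⟩, hc⟩ := lt_iSup_iff.1 hc
  have hne : y ≠ x := hy2
  have h1 : ∀ᶠ x' in 𝓝 x, y ∈ Metric.ball x' r := by
    have : ∀ᶠ x' in 𝓝 x, dist y x' < r :=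
      (continuous_const.dist continuous_id).continuousAt.eventually_lt continuousAt_const hy1
    exact this
  have h2 : ∀ᶠ x' in 𝓝 x, x' ≠ y := isOpen_ne.mem_nhds hne.symm
  have h3 : Tendsto (fun x' => edist (f y) (f x') / edist y x') (𝓝 x)
      (𝓝 (edist (f y) (f x) / edist y x)) :=
    ENNReal.Tendsto.div ((continuous_const.edist hf).tendsto x)
      (Or.inr (by simpa using hne)) ((continuous_const.edist continuous_id).tendsto x)
      (Or.inr (edist_ne_top _ _))
  filter_upwards [h1, h2, h3.eventually (lt_mem_nhds hc)] with x' a1 a2 a3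
  exact lt_iSup_iff.2 ⟨⟨a1, a2.symm⟩, a3⟩

lemma measurable_slope [MeasurableSpace X] [BorelSpace X] {f : X → ℝ} (hf : Continuous f) :
    Measurable (slope f) := by
  have : slope f = fun x => ⨅ n : ℕ, ⨆ y, ⨆ _ : y ∈ Metric.ball x (1 / ((n : ℝ) + 1)) ∩ {x}ᶜ,
      edist (f y) (f x) / edist y x := funext (slope_eq_iInf f)
  rw [this]
  exact Measurable.iInf fun n => (lowerSemicontinuous_iSup_quotient hf _).measurable

lemma slope_le_of_lipschitzWith {f : X → ℝ} {K : ℝ≥0} (hf : LipschitzWith K f) (x : X) :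
    slope f x ≤ K :=
  limsup_le_of_le (h := eventually_mem_nhdsWithin.mono fun y _ =>
    ENNReal.div_le_of_le_mul (hf y x))

lemma slope_ne_top_of_lipschitzWith {f : X → ℝ} {K : ℝ≥0} (hf : LipschitzWith K f) (x : X) :
    slope f x ≠ ∞ :=
  ne_top_of_le_ne_top ENNReal.coe_ne_top (slope_le_of_lipschitzWith hf x)

lemma slope_eq_zero_of_eventually_eq {f : X → ℝ} {x : X} (h : ∀ᶠ y in 𝓝 x, f y = f x) :
    slope f x = 0 := by
  refine le_antisymm ?_ bot_le
  refine limsup_le_of_le (h := ?_)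
  filter_upwards [nhdsWithin_le_nhds h] with y hy
  simp [hy]

lemma tendsto_inv_natCast_succ : Tendsto (fun n : ℕ => ((n : ℝ≥0∞) + 1)⁻¹) atTop (𝓝 0) := by
  have := (tendsto_add_atTop_iff_nat 1).2 ENNReal.tendsto_inv_nat_nhds_zero
  simpa using this

lemma inv_natCast_succ_pos (n : ℕ) : 0 < ((n : ℝ≥0∞) + 1)⁻¹ :=
  ENNReal.inv_pos.2 (by finiteness)

lemma limsup_le_comb {ι : Type*} {F : Filter ι} {u v w : ι → ℝ≥0∞} {a b c : ℝ≥0∞}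
    (ha : a ≠ ∞) (hb : b ≠ ∞) (hu : limsup u F ≠ ∞) (hv : limsup v F ≠ ∞)
    (h : ∀ᶠ y in F, w y ≤ a * u y + b * v y + c) :
    limsup w F ≤ a * limsup u F + b * limsup v F + c := by
  have hlim : ∀ U : ℝ≥0∞, ∀ d : ℝ≥0∞, d ≠ ∞ →
      Tendsto (fun n : ℕ => d * (U + ((n : ℝ≥0∞) + 1)⁻¹)) atTop (𝓝 (d * U)) := fun U d hd => by
    have := ENNReal.Tendsto.const_mul (a := d)
      ((tendsto_const_nhds (x := U)).add tendsto_inv_natCast_succ) (Or.inr hd)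
    simpa using this
  refine ge_of_tendsto (((hlim (limsup u F) a ha).add (hlim (limsup v F) b hb)).add_const c)
    (Eventually.of_forall fun n => ?_)
  refine limsup_le_of_le (h := ?_)
  filter_upwards [h, eventually_lt_of_limsup_lt (ENNReal.lt_add_right hu (inv_natCast_succ_pos n).ne'),
    eventually_lt_of_limsup_lt (ENNReal.lt_add_right hv (inv_natCast_succ_pos n).ne')] with y h1 h2 h3
  exact h1.trans (by gcongr)

lemma liminf_add_liminf_le (u v : ℕ → ℝ≥0∞) :
    liminf u atTop + liminf v atTop ≤ liminf (fun n => u n + v n) atTop := by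
  rw [liminf_eq_iSup_iInf_of_nat, liminf_eq_iSup_iInf_of_nat, liminf_eq_iSup_iInf_of_nat,
    ENNReal.iSup_add_iSup_of_monotone
      (fun i j hij => le_iInf₂ fun k hk => iInf₂_le k (hij.trans hk))
      (fun i j hij => le_iInf₂ fun k hk => iInf₂_le k (hij.trans hk))]
  exact iSup_mono fun n => le_iInf₂ fun k hk => add_le_add (iInf₂_le k hk) (iInf₂_le k hk)

lemma slope_le_add {f g h : X → ℝ} {x : X} {a b : ℝ} (ha : 0 ≤ a) (hb : 0 ≤ b)
    (hf : slope f x ≠ ∞) (hg : slope g x ≠ ∞) (H : ∀ ε > 0, ∀ᶠ y in 𝓝 x,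
      |h y - h x| ≤ a * |f y - f x| + b * |g y - g x| + ε * dist y x) :
    slope h x ≤ ENNReal.ofReal a * slope f x + ENNReal.ofReal b * slope g x := by
  refine ENNReal.le_of_forall_pos_le_add fun ε hε _ => ?_
  refine limsup_le_comb ENNReal.ofReal_ne_top ENNReal.ofReal_ne_top hf hg ?_
  filter_upwards [nhdsWithin_le_nhds (H ε hε), self_mem_nhdsWithin] with y hy hyx
  have hd0 : edist y x ≠ 0 := by simpa using hyx
  have hdt : edist y x ≠ ∞ := edist_ne_top _ _
  refine ENNReal.div_le_of_le_mul ?_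
  have e : ∀ p q : ℝ≥0∞, p * (q / edist y x) * edist y x = p * q := fun p q => by
    rw [mul_assoc, ENNReal.div_mul_cancel hd0 hdt]
  rw [add_mul, add_mul, e, e, edist_dist y x, edist_dist, edist_dist, edist_dist, Real.dist_eq,
    Real.dist_eq, Real.dist_eq,
    ← ENNReal.ofReal_coe_nnreal, ← ENNReal.ofReal_mul ha, ← ENNReal.ofReal_mul hb,
    ← ENNReal.ofReal_mul ε.coe_nonneg, ← ENNReal.ofReal_add (by positivity) (by positivity),
    ← ENNReal.ofReal_add (by positivity) (by positivity)]
  exact ENNReal.ofReal_le_ofReal hy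

/-- Since `f - g` is Lipschitz, the `o(|Δ(f - g)|)` remainder of `ψ` becomes at most `ε * dist y x`.
The extra `1` in `K + L + 1` avoids a zero divisor. -/
lemma eventually_sub_contraction {f g : X → ℝ} {K L : ℝ≥0} (hf : LipschitzWith K f)
    (hg : LipschitzWith L g) {ψ : ℝ → ℝ} {c : ℝ} {x : X} (hψ : HasDerivAt ψ c (f x - g x))
    {ε : ℝ} (hε : 0 < ε) :
    ∀ᶠ y in 𝓝 x, |ψ (f y - g y) - ψ (f x - g x) - c * ((f y - g y) - (f x - g x))| ≤
      ε * dist y x := by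
  have h1 := hψ.isLittleO
  have hc : Tendsto (fun y => f y - g y) (𝓝 x) (𝓝 (f x - g x)) :=
    (hf.continuous.sub hg.continuous).tendsto x
  have hK : (0 : ℝ) < K + L + 1 := by positivity
  have h2 := hc.eventually (h1.def (show 0 < ε / (K + L + 1) by positivity))
  filter_upwards [h2] with y hy
  simp only [smul_eq_mul, Real.norm_eq_abs] at hy
  rw [mul_comm c]
  refine hy.trans ?_
  have e1 := hf.dist_le_mul y x
  have e2 := hg.dist_le_mul y x
  rw [Real.dist_eq] at e1 e2
  have e3 : |f y - g y - (f x - g x)| ≤ (K + L + 1) * dist y x := by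
    have : f y - g y - (f x - g x) = (f y - f x) - (g y - g x) := by ring
    rw [this]
    have := abs_sub (f y - f x) (g y - g x)
    have := dist_nonneg (x := y) (y := x)
    linarith
  calc _ ≤ ε / (K + L + 1) * ((K + L + 1) * dist y x) := by gcongr
    _ = _ := by field_simp

/-- To first order, the increment of `f - ψ(f - g)` is `(1 - c) Δf + c Δg`, a convex combination. -/
lemma slope_sub_contraction_le {f g : X → ℝ} {K L : ℝ≥0} (hf : LipschitzWith K f)
    (hg : LipschitzWith L g) {ψ : ℝ → ℝ} {c : ℝ} (hc0 : 0 ≤ c) (hc1 : c ≤ 1) {x : X}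
    (hψ : HasDerivAt ψ c (f x - g x)) :
    slope (fun y => f y - ψ (f y - g y)) x ≤
      ENNReal.ofReal (1 - c) * slope f x + ENNReal.ofReal c * slope g x := by
  refine slope_le_add (by linarith) hc0 (slope_ne_top_of_lipschitzWith hf x)
    (slope_ne_top_of_lipschitzWith hg x) fun ε hε => ?_
  filter_upwards [eventually_sub_contraction hf hg hψ hε] with y hy
  have e : f y - ψ (f y - g y) - (f x - ψ (f x - g x)) = (1 - c) * (f y - f x) + c * (g y - g x) -
    (ψ (f y - g y) - ψ (f x - g x) - c * ((f y - g y) - (f x - g x))) := by ring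
  rw [e]
  refine (abs_sub _ _).trans (add_le_add ((abs_add_le _ _).trans ?_) hy)
  rw [abs_mul, abs_mul, abs_of_nonneg hc0, abs_of_nonneg (sub_nonneg.2 hc1)]

lemma slope_add_contraction_le {f g : X → ℝ} {K L : ℝ≥0} (hf : LipschitzWith K f)
    (hg : LipschitzWith L g) {ψ : ℝ → ℝ} {c : ℝ} (hc0 : 0 ≤ c) (hc1 : c ≤ 1) {x : X}
    (hψ : HasDerivAt ψ c (f x - g x)) :
    slope (fun y => g y + ψ (f y - g y)) x ≤
      ENNReal.ofReal c * slope f x + ENNReal.ofReal (1 - c) * slope g x := by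
  refine slope_le_add hc0 (by linarith) (slope_ne_top_of_lipschitzWith hf x)
    (slope_ne_top_of_lipschitzWith hg x) fun ε hε => ?_
  filter_upwards [eventually_sub_contraction hf hg hψ hε] with y hy
  have e : g y + ψ (f y - g y) - (g x + ψ (f x - g x)) = (c * (f y - f x) + (1 - c) * (g y - g x)) +
    (ψ (f y - g y) - ψ (f x - g x) - c * ((f y - g y) - (f x - g x))) := by ring
  rw [e]
  refine (abs_add_le _ _).trans (add_le_add ((abs_add_le _ _).trans ?_) hy)
  rw [abs_mul, abs_mul, abs_of_nonneg hc0, abs_of_nonneg (sub_nonneg.2 hc1)]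

lemma sq_comb_le {a b : ℝ} (ha : 0 ≤ a) (hb : 0 ≤ b) (hab : a + b = 1) (x y : ℝ≥0∞) :
    (ENNReal.ofReal a * x + ENNReal.ofReal b * y) ^ 2 ≤
      ENNReal.ofReal a * x ^ 2 + ENNReal.ofReal b * y ^ 2 := by
  have h := ENNReal.rpow_arith_mean_le_arith_mean2_rpow (ENNReal.ofReal a) (ENNReal.ofReal b) x y
    (by rw [← ENNReal.ofReal_add ha hb, hab, ENNReal.ofReal_one]) (p := 2) (by norm_num)
  simpa using h

lemma slope_const_mul_le (c : ℝ) {f : X → ℝ} {x : X} (hf : slope f x ≠ ∞) :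
    slope (fun y => c * f y) x ≤ ENNReal.ofReal |c| * slope f x := by
  have h := slope_le_add (f := f) (g := f) (h := fun y => c * f y) (x := x) (abs_nonneg c) le_rfl
    hf hf fun ε hε => Eventually.of_forall fun y => by
      rw [← mul_sub, abs_mul]
      have : 0 ≤ ε * dist y x := by positivity
      linarith
  simpa using h

end Slope

/-! ### Stability of bounded Lipschitz functions -/

section LipB

variable {X : Type*} [MetricSpace X] {f g : X → ℝ}

lemma IsLipB.continuous (hf : IsLipB f) : Continuous f := hf.1.choose_spec.continuous

lemma IsLipB.slope_ne_top (hf : IsLipB f) (x : X) : slope f x ≠ ∞ :=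
  slope_ne_top_of_lipschitzWith hf.1.choose_spec x

lemma IsLipB.add (hf : IsLipB f) (hg : IsLipB g) : IsLipB fun x => f x + g x := by
  obtain ⟨⟨K, hK⟩, C, hC⟩ := hf
  obtain ⟨⟨L, hL⟩, D, hD⟩ := hg
  exact ⟨⟨_, hK.add hL⟩, C + D, fun x => (abs_add_le _ _).trans (add_le_add (hC x) (hD x))⟩

lemma IsLipB.comp {ψ : ℝ → ℝ} {K : ℝ≥0} (hψ : LipschitzWith K ψ) (hψ0 : ψ 0 = 0)
    (hf : IsLipB f) : IsLipB fun x => ψ (f x) := by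
  obtain ⟨⟨L, hL⟩, D, hD⟩ := hf
  refine ⟨⟨_, hψ.comp hL⟩, K * D, fun x => ?_⟩
  have h := hψ.dist_le_mul (f x) 0
  rw [hψ0, dist_zero_right, dist_zero_right, Real.norm_eq_abs, Real.norm_eq_abs] at h
  exact h.trans (mul_le_mul_of_nonneg_left (hD x) K.2)

lemma IsLipB.const_mul (c : ℝ) (hf : IsLipB f) : IsLipB fun x => c * f x :=
  hf.comp (ψ := fun s => c * s) (lipschitzWith_smul c) (mul_zero c)

lemma IsLipB.sub (hf : IsLipB f) (hg : IsLipB g) : IsLipB fun x => f x - g x := by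
  simpa [sub_eq_add_neg] using hf.add (hg.const_mul (-1))

end LipB

/-! ### The Cheeger energy: semicontinuity, convexity, homogeneity, exchange inequality -/

section Energy

variable {X : Type*} [MetricSpace X] [MeasurableSpace X] {m : Measure X}

/-- The Dirichlet energy of a function, defined by its slope. -/
def energy (m : Measure X) (F : X → ℝ) : ℝ≥0∞ := 2⁻¹ * ∫⁻ x, slope F x ^ 2 ∂m

lemma cheeger_le_liminf {f : Lp ℝ 2 m} {F : ℕ → X → ℝ}
    (hF : ∀ n, IsLipB (F n) ∧ MemLp (F n) 2 m)
    (h : Tendsto (fun n => eLpNorm (fun x => F n x - f x) 2 m) atTop (𝓝 0)) :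
    cheeger m f ≤ liminf (fun n => energy m (F n)) atTop :=
  sInf_le ⟨F, hF, h, rfl⟩

lemma exists_approx_of_cheeger_lt {f : Lp ℝ 2 m} {c : ℝ≥0∞} (h : cheeger m f < c)
    {ε : ℝ≥0∞} (hε : 0 < ε) :
    ∃ F, IsLipB F ∧ MemLp F 2 m ∧ eLpNorm (fun x => F x - f x) 2 m ≤ ε ∧ energy m F < c := by
  obtain ⟨_, ⟨F, hF, hlim, rfl⟩, hlt⟩ := sInf_lt_iff.1 h
  obtain ⟨n, h1, h2⟩ := ((frequently_lt_of_liminf_lt (by isBoundedDefault) hlt).and_eventually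
    (hlim.eventually (gt_mem_nhds hε))).exists
  exact ⟨F n, (hF n).1, (hF n).2, h2.le, h1⟩

lemma cheeger_le_of_approx {f : Lp ℝ 2 m} {c : ℝ≥0∞}
    (h : ∀ ε : ℝ≥0∞, 0 < ε → ∃ F, IsLipB F ∧ MemLp F 2 m ∧
      eLpNorm (fun x => F x - f x) 2 m ≤ ε ∧ energy m F ≤ c) : cheeger m f ≤ c := by
  choose F h1 h2 h3 h4 using fun n : ℕ => h _ (inv_natCast_succ_pos n)
  refine (cheeger_le_liminf (F := F) (fun n => ⟨h1 n, h2 n⟩)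
    (tendsto_of_tendsto_of_tendsto_of_le_of_le tendsto_const_nhds tendsto_inv_natCast_succ
      (fun _ => zero_le) h3)).trans ?_
  exact liminf_le_of_le (h := fun b hb => by
    obtain ⟨n, hn⟩ := hb.exists
    exact hn.trans (h4 n))

lemma lowerSemicontinuous_cheeger : LowerSemicontinuous (cheeger m) := by
  intro f c hc
  by_contra hcon
  obtain ⟨b, hcb, hb⟩ := exists_between hc
  refine absurd (cheeger_le_of_approx (f := f) (c := b) fun ε hε => ?_) (not_le.2 hb)
  have hε2 : 0 < ε / 2 := ENNReal.half_pos hε.ne'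
  have hfr : ∃ᶠ g in 𝓝 f, cheeger m g ≤ c := by
    simpa [Filter.not_eventually] using hcon
  obtain ⟨g, hg1, hg2⟩ := (hfr.and_eventually (Metric.eball_mem_nhds f hε2)).exists
  obtain ⟨F, h1, h2, h3, h4⟩ := exists_approx_of_cheeger_lt (hg1.trans_lt hcb) hε2
  refine ⟨F, h1, h2, ?_, h4.le⟩
  have e : (fun x => F x - f x) = (fun x => F x - g x) + fun x => g x - f x := by
    ext x; simp
  rw [e]
  refine (eLpNorm_add_le (h2.1.sub (Lp.aestronglyMeasurable g))
    ((Lp.aestronglyMeasurable g).sub (Lp.aestronglyMeasurable f)) one_le_two).trans ?_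
  rw [← ENNReal.add_halves ε]
  refine add_le_add h3 ?_
  have := le_of_lt (Metric.mem_eball.1 hg2)
  rwa [Lp.edist_def] at this

lemma eLpNorm_le_comb {α : Type*} [MeasurableSpace α] {μ : Measure α} {h p q : α → ℝ}
    (hp : AEStronglyMeasurable p μ) (hq : AEStronglyMeasurable q μ) (a b : ℝ≥0)
    (H : ∀ᵐ x ∂μ, |h x| ≤ a * |p x| + b * |q x|) :
    eLpNorm h 2 μ ≤ a * eLpNorm p 2 μ + b * eLpNorm q 2 μ := by
  have h1 : eLpNorm h 2 μ ≤ eLpNorm ((fun x => (a : ℝ) * |p x|) + fun x => (b : ℝ) * |q x|) 2 μ :=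
    eLpNorm_mono_ae_real (by simpa using H)
  refine h1.trans ((eLpNorm_add_le ?_ ?_ one_le_two).trans (add_le_add ?_ ?_))
  · exact (hp.norm).const_mul _
  · exact (hq.norm).const_mul _
  · refine (eLpNorm_const_smul_le (c := (a : ℝ)) (f := fun x => |p x|)).trans ?_
    rw [show (fun x => |p x|) = fun x => ‖p x‖ from rfl, eLpNorm_norm]
    simp
  · refine (eLpNorm_const_smul_le (c := (b : ℝ)) (f := fun x => |q x|)).trans ?_
    rw [show (fun x => |q x|) = fun x => ‖q x‖ from rfl, eLpNorm_norm]
    simp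

variable [BorelSpace X]

lemma energy_comb_le {f g : X → ℝ} (hf : IsLipB f) (hg : IsLipB g) {s : ℝ} (h0 : 0 ≤ s)
    (h1 : s ≤ 1) : energy m (fun x => (1 - s) * f x + s * g x) ≤
      ENNReal.ofReal (1 - s) * energy m f + ENNReal.ofReal s * energy m g := by
  obtain ⟨⟨K, hK⟩, -⟩ := id hf
  obtain ⟨⟨L, hL⟩, -⟩ := id hg
  have hpt : ∀ x, slope (fun x => (1 - s) * f x + s * g x) x ^ 2 ≤
      ENNReal.ofReal (1 - s) * slope f x ^ 2 + ENNReal.ofReal s * slope g x ^ 2 := fun x => by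
    refine le_trans ?_ (sq_comb_le (by linarith) h0 (by ring) _ _)
    gcongr
    have := slope_sub_contraction_le hK hL (ψ := fun r => s * r) h0 h1 (x := x)
      (by simpa using (hasDerivAt_id (f x - g x)).const_mul s)
    convert! this using 2
    ext y; ring
  have hm1 := (measurable_slope hf.continuous).pow_const 2
  have hm2 := (measurable_slope hg.continuous).pow_const 2
  unfold energy
  calc _ ≤ 2⁻¹ * ∫⁻ x, (ENNReal.ofReal (1 - s) * slope f x ^ 2 +
        ENNReal.ofReal s * slope g x ^ 2) ∂m := by gcongr; exact hpt _
    _ = _ := by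
      rw [lintegral_add_left (hm1.const_mul _), lintegral_const_mul _ hm1,
        lintegral_const_mul _ hm2]
      ring

/-- The coefficients `(1 - c, c)` and `(c, 1 - c)` form a doubly stochastic matrix: convexity of the
square uses that rows sum to `1`, and adding the two bounds uses the columns. -/
lemma energy_contraction_add_le {f g : X → ℝ} (hf : IsLipB f) (hg : IsLipB g) {ψ : ℝ → ℝ}
    (hψl : LipschitzWith 1 ψ) (hψ0 : ψ 0 = 0)
    (hψ : ∀ s, ∃ c, 0 ≤ c ∧ c ≤ 1 ∧ HasDerivAt ψ c s) :
    energy m (fun x => f x - ψ (f x - g x)) + energy m (fun x => g x + ψ (f x - g x)) ≤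
      energy m f + energy m g := by
  obtain ⟨⟨K, hK⟩, -⟩ := id hf
  obtain ⟨⟨L, hL⟩, -⟩ := id hg
  have hpt : ∀ x, slope (fun x => f x - ψ (f x - g x)) x ^ 2 +
      slope (fun x => g x + ψ (f x - g x)) x ^ 2 ≤ slope f x ^ 2 + slope g x ^ 2 := fun x => by
    obtain ⟨c, hc0, hc1, hc⟩ := hψ (f x - g x)
    have h1 := slope_sub_contraction_le hK hL hc0 hc1 hc
    have h2 := slope_add_contraction_le hK hL hc0 hc1 hc
    calc _ ≤ (ENNReal.ofReal (1 - c) * slope f x ^ 2 + ENNReal.ofReal c * slope g x ^ 2) +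
          (ENNReal.ofReal c * slope f x ^ 2 + ENNReal.ofReal (1 - c) * slope g x ^ 2) := by
          refine add_le_add (le_trans ?_ (sq_comb_le (by linarith) hc0 (by ring) _ _))
            (le_trans ?_ (sq_comb_le hc0 (by linarith) (by ring) _ _))
          · gcongr
          · gcongr
      _ = (ENNReal.ofReal (1 - c) + ENNReal.ofReal c) * (slope f x ^ 2 + slope g x ^ 2) := by ring
      _ = _ := by
        rw [← ENNReal.ofReal_add (by linarith) hc0]; simp
  have hm1 := (measurable_slope hf.continuous).pow_const 2
  have hm2 := (measurable_slope (hf.sub ((hf.sub hg).comp hψl hψ0)).continuous).pow_const 2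
  unfold energy
  rw [← mul_add, ← mul_add, ← lintegral_add_left hm1, ← lintegral_add_left hm2]
  exact mul_le_mul_right (lintegral_mono hpt) _

lemma energy_const_mul_le (c : ℝ) {f : X → ℝ} (hf : IsLipB f) :
    energy m (fun x => c * f x) ≤ ENNReal.ofReal (c ^ 2) * energy m f := by
  unfold energy
  calc _ ≤ 2⁻¹ * ∫⁻ x, ENNReal.ofReal (c ^ 2) * slope f x ^ 2 ∂m := by
        gcongr with x
        have := slope_const_mul_le c (hf.slope_ne_top x)
        calc _ ≤ (ENNReal.ofReal |c| * slope f x) ^ 2 := by gcongr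
          _ = _ := by rw [mul_pow, ← ENNReal.ofReal_pow (abs_nonneg c), sq_abs]
    _ = _ := by
      rw [lintegral_const_mul _ ((measurable_slope hf.continuous).pow_const 2)]; ring

lemma cheeger_const_smul_le (c : ℝ) (f : Lp ℝ 2 m) :
    cheeger m (c • f) ≤ ENNReal.ofReal (c ^ 2) * cheeger m f := by
  by_cases hfin : cheeger m f = ∞
  -- When `c = 0` the right side is `0 * ∞ = 0`, so `Ch 0 = 0` has to be shown by hand.
  · rcases eq_or_ne c 0 with rfl | hc
    · rw [zero_smul]
      refine (cheeger_le_of_approx fun ε hε => ⟨fun _ => 0, ⟨⟨0, LipschitzWith.const 0⟩, 0, by simp⟩,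
        MemLp.zero, ?_, ?_⟩).trans zero_le
      · refine le_trans (le_of_eq ?_) zero_le
        refine (eLpNorm_congr_ae (g := 0) ?_).trans eLpNorm_zero
        filter_upwards [Lp.coeFn_zero ℝ 2 m] with x hx
        rw [hx]; simp
      · unfold energy
        simp [slope_eq_zero_of_eventually_eq]
    · rw [hfin, ENNReal.mul_top (by positivity)]
      exact le_top
  refine ENNReal.le_of_forall_pos_le_add fun δ hδ _ => ?_
  obtain ⟨η, hη, hηδ⟩ : ∃ η : ℝ≥0∞, 0 < η ∧ ENNReal.ofReal (c ^ 2) * η ≤ δ := by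
    refine ⟨δ / (ENNReal.ofReal (c ^ 2) + 1), ENNReal.div_pos (by simpa using hδ.ne')
      (by finiteness), ?_⟩
    rw [← mul_div_assoc, mul_comm, mul_div_assoc]
    refine mul_le_of_le_one_right zero_le (ENNReal.div_le_of_le_mul ?_)
    simp
  refine cheeger_le_of_approx fun ε hε => ?_
  obtain ⟨F, h1, h2, h3, h4⟩ := exists_approx_of_cheeger_lt
    (ENNReal.lt_add_right hfin hη.ne')
    (show 0 < ε / (‖c‖ₑ + 1) from ENNReal.div_pos hε.ne' (by finiteness))
  refine ⟨fun x => c * F x, h1.const_mul c, h2.const_mul c, ?_, ?_⟩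
  · have : eLpNorm (fun x => c * F x - (c • f : Lp ℝ 2 m) x) 2 m =
        eLpNorm (c • fun x => F x - f x) 2 m := by
      refine eLpNorm_congr_ae ?_
      filter_upwards [Lp.coeFn_smul c f] with x hx
      simp [hx]; ring
    rw [this]
    calc _ ≤ ‖c‖ₑ * (ε / (‖c‖ₑ + 1)) := eLpNorm_const_smul_le.trans (by gcongr)
      _ ≤ ε := by
        rw [← mul_div_assoc, mul_comm, mul_div_assoc]
        refine mul_le_of_le_one_right zero_le (ENNReal.div_le_of_le_mul ?_)
        simp
  · calc _ ≤ _ := energy_const_mul_le c h1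
      _ ≤ ENNReal.ofReal (c ^ 2) * (cheeger m f + η) := by gcongr
      _ ≤ _ := by rw [mul_add]; gcongr

lemma cheeger_zero : cheeger m (0 : Lp ℝ 2 m) = 0 := by
  have := cheeger_const_smul_le 0 (0 : Lp ℝ 2 m)
  simpa using this

lemma cheeger_const_smul {c : ℝ} (hc : 0 < c) (f : Lp ℝ 2 m) :
    cheeger m (c • f) = ENNReal.ofReal (c ^ 2) * cheeger m f := by
  refine le_antisymm (cheeger_const_smul_le c f) ?_
  have h := cheeger_const_smul_le c⁻¹ (c • f)
  rw [smul_smul, inv_mul_cancel₀ hc.ne', one_smul] at h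
  calc _ ≤ ENNReal.ofReal (c ^ 2) * (ENNReal.ofReal (c⁻¹ ^ 2) * cheeger m (c • f)) := by gcongr
    _ = _ := by
      rw [← mul_assoc, ← ENNReal.ofReal_mul (by positivity), ← mul_pow, mul_inv_cancel₀ hc.ne']
      simp

lemma cheeger_convex (f g : Lp ℝ 2 m) (s : ℝ) (h0 : 0 ≤ s) (h1 : s ≤ 1) :
    cheeger m ((1 - s) • f + s • g) ≤
      ENNReal.ofReal (1 - s) * cheeger m f + ENNReal.ofReal s * cheeger m g := by
  -- The endpoints are separated because `0 * ∞ = 0` would spoil the reduction to finite energies.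
  rcases h0.eq_or_lt with rfl | h0'
  · simp
  rcases h1.eq_or_lt with rfl | h1'
  · simp
  by_cases hf : cheeger m f = ∞
  · rw [hf, ENNReal.mul_top (by simpa using h1'), top_add]; exact le_top
  by_cases hg : cheeger m g = ∞
  · rw [hg, ENNReal.mul_top (by simpa using h0'), add_top]; exact le_top
  refine ENNReal.le_of_forall_pos_le_add fun δ hδ _ => ?_
  have hδ' : (δ : ℝ≥0∞) ≠ 0 := by simpa using hδ.ne'
  refine cheeger_le_of_approx fun ε hε => ?_
  have hε2 : 0 < ε / 2 := ENNReal.half_pos hε.ne'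
  obtain ⟨F, F1, F2, F3, F4⟩ := exists_approx_of_cheeger_lt (ENNReal.lt_add_right hf hδ') hε2
  obtain ⟨G, G1, G2, G3, G4⟩ := exists_approx_of_cheeger_lt (ENNReal.lt_add_right hg hδ') hε2
  refine ⟨fun x => (1 - s) * F x + s * G x, (F1.const_mul _).add (G1.const_mul _),
    (F2.const_mul _).add (G2.const_mul _), ?_, ?_⟩
  · refine (eLpNorm_le_comb (p := fun x => F x - f x) (q := fun x => G x - g x)
      (F2.1.sub (Lp.aestronglyMeasurable f)) (G2.1.sub (Lp.aestronglyMeasurable g)) 1 1 ?_).trans ?_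
    · filter_upwards [Lp.coeFn_add ((1 - s) • f) (s • g), Lp.coeFn_smul (1 - s) f,
        Lp.coeFn_smul s g] with x e1 e2 e3
      simp only [e1, Pi.add_apply, e2, e3, Pi.smul_apply, smul_eq_mul, NNReal.coe_one, one_mul]
      rw [show (1 - s) * F x + s * G x - ((1 - s) * f x + s * g x) =
        (1 - s) * (F x - f x) + s * (G x - g x) by ring]
      refine (abs_add_le _ _).trans (add_le_add ?_ ?_)
      · rw [abs_mul, abs_of_nonneg (by linarith)]
        exact mul_le_of_le_one_left (abs_nonneg _) (by linarith)
      · rw [abs_mul, abs_of_nonneg h0]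
        exact mul_le_of_le_one_left (abs_nonneg _) h1
    · simp only [ENNReal.coe_one, one_mul]
      rw [← ENNReal.add_halves ε]
      exact add_le_add F3 G3
  · refine (energy_comb_le F1 G1 h0 h1).trans ?_
    calc _ ≤ ENNReal.ofReal (1 - s) * (cheeger m f + δ) + ENNReal.ofReal s * (cheeger m g + δ) := by
          gcongr
      _ = ENNReal.ofReal (1 - s) * cheeger m f + ENNReal.ofReal s * cheeger m g +
          (ENNReal.ofReal (1 - s) + ENNReal.ofReal s) * δ := by ring
      _ = _ := by
        rw [← ENNReal.ofReal_add (by linarith) h0]; simp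

/-- Complete accretivity of the Cheeger energy: it decreases under exchange of contractions of
the difference. -/
lemma cheeger_contraction_add_le (f g : Lp ℝ 2 m) {ψ : ℝ → ℝ}
    (hψl : LipschitzWith 1 ψ) (hψ0 : ψ 0 = 0)
    (hψ : ∀ s, ∃ c, 0 ≤ c ∧ c ≤ 1 ∧ HasDerivAt ψ c s) :
    cheeger m (f - hψl.compLp hψ0 (f - g)) + cheeger m (g + hψl.compLp hψ0 (f - g)) ≤
      cheeger m f + cheeger m g := by
  by_cases hf : cheeger m f = ∞
  · simp [hf]
  by_cases hg : cheeger m g = ∞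
  · simp [hg]
  refine ENNReal.le_of_forall_pos_le_add fun δ hδ _ => ?_
  have hδ' : (δ : ℝ≥0∞) / 2 ≠ 0 := by simpa using hδ.ne'
  -- Both modified functions are approximated from the same sequences `F, G`: only the sum of their
  -- energies is controlled, so the two liminfs must be taken jointly.
  choose F F1 F2 F3 F4 using fun n : ℕ =>
    exists_approx_of_cheeger_lt (ENNReal.lt_add_right hf hδ') (inv_natCast_succ_pos n)
  choose G G1 G2 G3 G4 using fun n : ℕ =>
    exists_approx_of_cheeger_lt (ENNReal.lt_add_right hg hδ') (inv_natCast_succ_pos n)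
  have hlim : Tendsto (fun n : ℕ => ((2 : ℝ≥0) : ℝ≥0∞) * ((n : ℝ≥0∞) + 1)⁻¹ +
      ((2 : ℝ≥0) : ℝ≥0∞) * ((n : ℝ≥0∞) + 1)⁻¹) atTop (𝓝 0) := by
    have := ENNReal.Tendsto.const_mul (a := ((2 : ℝ≥0) : ℝ≥0∞)) tendsto_inv_natCast_succ
      (Or.inr ENNReal.coe_ne_top)
    simpa using this.add this
  have hψd : ∀ a b a' b' : ℝ, |ψ (a - b) - ψ (a' - b')| ≤ |a - a'| + |b - b'| := by
    intro a b a' b'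
    have := hψl.dist_le_mul (a - b) (a' - b')
    rw [Real.dist_eq, Real.dist_eq, NNReal.coe_one, one_mul] at this
    refine this.trans ?_
    rw [show a - b - (a' - b') = (a - a') - (b - b') by ring]
    exact abs_sub _ _
  have hcoe : ∀ᵐ x ∂m, (hψl.compLp hψ0 (f - g) : Lp ℝ 2 m) x = ψ (f x - g x) := by
    filter_upwards [hψl.coeFn_compLp hψ0 (f - g), Lp.coeFn_sub f g] with x e1 e2
    rw [e1, Function.comp_apply, e2, Pi.sub_apply]
  have hm : ∀ n, MemLp (fun x => ψ (F n x - G n x)) 2 m := fun n =>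
    hψl.comp_memLp hψ0 ((F2 n).sub (G2 n))
  have hl : ∀ n, IsLipB fun x => ψ (F n x - G n x) := fun n => ((F1 n).sub (G1 n)).comp hψl hψ0
  have hU : cheeger m (f - hψl.compLp hψ0 (f - g)) ≤
      liminf (fun n => energy m fun x => F n x - ψ (F n x - G n x)) atTop := by
    refine cheeger_le_liminf (fun n => ⟨(F1 n).sub (hl n), (F2 n).sub (hm n)⟩)
      (tendsto_of_tendsto_of_tendsto_of_le_of_le tendsto_const_nhds hlim (fun _ => zero_le)
        fun n => ?_)
    -- The error is at most `2|F n - f| + |G n - g|`; taking `2` for both coefficients keeps the two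
    -- cases symmetric.
    refine (eLpNorm_le_comb (p := fun x => F n x - f x) (q := fun x => G n x - g x)
      ((F2 n).1.sub (Lp.aestronglyMeasurable f)) ((G2 n).1.sub (Lp.aestronglyMeasurable g)) 2 2
      ?_).trans (add_le_add (by gcongr; exact F3 n) (by gcongr; exact G3 n))
    filter_upwards [hcoe, Lp.coeFn_sub f (hψl.compLp hψ0 (f - g))] with x e1 e2
    rw [e2, Pi.sub_apply, e1, show F n x - ψ (F n x - G n x) - (f x - ψ (f x - g x)) =
      (F n x - f x) - (ψ (F n x - G n x) - ψ (f x - g x)) by ring]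
    have h1 := hψd (F n x) (G n x) (f x) (g x)
    have h2 := abs_sub (F n x - f x) (ψ (F n x - G n x) - ψ (f x - g x))
    have h3 := abs_nonneg (G n x - g x)
    norm_num
    linarith
  have hV : cheeger m (g + hψl.compLp hψ0 (f - g)) ≤
      liminf (fun n => energy m fun x => G n x + ψ (F n x - G n x)) atTop := by
    refine cheeger_le_liminf (fun n => ⟨(G1 n).add (hl n), (G2 n).add (hm n)⟩)
      (tendsto_of_tendsto_of_tendsto_of_le_of_le tendsto_const_nhds hlim (fun _ => zero_le)
        fun n => ?_)
    refine (eLpNorm_le_comb (p := fun x => F n x - f x) (q := fun x => G n x - g x)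
      ((F2 n).1.sub (Lp.aestronglyMeasurable f)) ((G2 n).1.sub (Lp.aestronglyMeasurable g)) 2 2
      ?_).trans (add_le_add (by gcongr; exact F3 n) (by gcongr; exact G3 n))
    filter_upwards [hcoe, Lp.coeFn_add g (hψl.compLp hψ0 (f - g))] with x e1 e2
    rw [e2, Pi.add_apply, e1, show G n x + ψ (F n x - G n x) - (g x + ψ (f x - g x)) =
      (G n x - g x) + (ψ (F n x - G n x) - ψ (f x - g x)) by ring]
    have h1 := hψd (F n x) (G n x) (f x) (g x)
    have h2 := abs_add_le (G n x - g x) (ψ (F n x - G n x) - ψ (f x - g x))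
    have h3 := abs_nonneg (F n x - f x)
    norm_num
    linarith
  refine (add_le_add hU hV).trans ((liminf_add_liminf_le _ _).trans ?_)
  refine liminf_le_of_le (h := fun b hb => ?_)
  obtain ⟨n, hn⟩ := hb.exists
  refine hn.trans ((energy_contraction_add_le (F1 n) (G1 n) hψl hψ0 hψ).trans ?_)
  calc _ ≤ (cheeger m f + δ / 2) + (cheeger m g + δ / 2) := add_le_add (F4 n).le (G4 n).le
    _ = cheeger m f + cheeger m g + (δ / 2 + δ / 2) := by ring
    _ = _ := by rw [ENNReal.add_halves]

end Energy

/-! ### Functions of finite energy are dense in `L²` -/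

section Density

variable {X : Type*} [MetricSpace X] [MeasurableSpace X] [BorelSpace X] {m : Measure X}

/-- Bounded Lipschitz square integrable functions with finite energy. -/
def IsFiniteEnergyLipB (m : Measure X) (F : X → ℝ) : Prop :=
  IsLipB F ∧ MemLp F 2 m ∧ energy m F ≠ ∞

lemma IsFiniteEnergyLipB.add {F G : X → ℝ} (hF : IsFiniteEnergyLipB m F)
    (hG : IsFiniteEnergyLipB m G) : IsFiniteEnergyLipB m (F + G) := by
  refine ⟨hF.1.add hG.1, hF.2.1.add hG.2.1, ?_⟩
  have h := energy_comb_le (m := m) (hF.1.const_mul 2) (hG.1.const_mul 2) (s := 1 / 2)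
    (by norm_num) (by norm_num)
  have e : (fun x => (1 - 1 / 2) * (2 * F x) + 1 / 2 * (2 * G x)) = F + G := by
    ext x; simp only [Pi.add_apply]; ring
  rw [e] at h
  have h1 := energy_const_mul_le (m := m) 2 hF.1
  have h2 := energy_const_mul_le (m := m) 2 hG.1
  have h1' : energy m (fun x => 2 * F x) ≠ ∞ :=
    ne_top_of_le_ne_top (ENNReal.mul_ne_top ENNReal.ofReal_ne_top hF.2.2) h1
  have h2' : energy m (fun x => 2 * G x) ≠ ∞ :=
    ne_top_of_le_ne_top (ENNReal.mul_ne_top ENNReal.ofReal_ne_top hG.2.2) h2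
  exact ne_top_of_le_ne_top (by finiteness) h

omit [BorelSpace X] in
lemma IsFiniteEnergyLipB.cheeger_ne_top {F : X → ℝ} (hF : IsFiniteEnergyLipB m F) :
    cheeger m (hF.2.1.toLp F) ≠ ∞ := by
  refine ne_top_of_le_ne_top hF.2.2 (cheeger_le_of_approx fun ε hε =>
    ⟨F, hF.1, hF.2.1, ?_, le_rfl⟩)
  refine le_trans (le_of_eq ?_) zero_le
  refine (eLpNorm_congr_ae (g := 0) ?_).trans eLpNorm_zero
  filter_upwards [hF.2.1.coeFn_toLp] with x hx
  simp [hx]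

/-- A multiple of the thickened indicator works: its slope is bounded, vanishes off a bounded closed
thickening of `F`, and bounded sets have finite measure. -/
lemma exists_isFiniteEnergyLipB_of_isClosed (hm : ∀ (x : X) (r : ℝ), m (Metric.ball x r) < ∞)
    {F : Set X} (hF : IsClosed F) (hFb : Bornology.IsBounded F) (c : ℝ) {η : ℝ≥0∞} (hη : η ≠ 0) :
    ∃ g : X → ℝ, IsFiniteEnergyLipB m g ∧ (∀ x ∈ F, g x = c) ∧ (∀ x, |g x| ≤ |c|) ∧
      (∀ x, |g x - c| ≤ |c|) ∧
      ∃ A, IsClosed A ∧ (∀ x ∉ A, g x = 0) ∧ F ⊆ A ∧ m (A \ F) ≤ η := by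
  have hbd : ∀ {A : Set X}, Bornology.IsBounded A → m A ≠ ∞ := by
    intro A hA
    rcases A.eq_empty_or_nonempty with rfl | ⟨o, ho⟩
    · simp
    obtain ⟨r, hr⟩ := hA.subset_ball o
    exact ne_top_of_le_ne_top (hm o r).ne (measure_mono hr)
  have hmF := hbd hFb
  have hlim := tendsto_measure_cthickening_of_isClosed (μ := m) (s := F)
    ⟨1, one_pos, hbd hFb.cthickening⟩ hF
  have hev : ∀ᶠ r in 𝓝[>] (0 : ℝ), m (Metric.cthickening r F) < m F + η :=
    (tendsto_nhdsWithin_of_tendsto_nhds tendsto_id).eventually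
      (hlim.eventually (gt_mem_nhds (ENNReal.lt_add_right hmF hη)))
  obtain ⟨δ, hδ, hδ0⟩ := (hev.and self_mem_nhdsWithin).exists
  have hδ0 : 0 < δ := hδ0
  have hA : m (Metric.cthickening δ F) ≠ ∞ := hbd hFb.cthickening
  let g : X → ℝ := fun x => c * (thickenedIndicator hδ0 F x : ℝ)
  have hle : ∀ x, (thickenedIndicator hδ0 F x : ℝ) ≤ 1 := fun x => by
    exact_mod_cast thickenedIndicator_le_one hδ0 F x
  have hgb : ∀ x, |g x| ≤ |c| := fun x => by
    rw [abs_mul, NNReal.abs_eq]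
    exact mul_le_of_le_one_right (abs_nonneg _) (hle x)
  have hgc : ∀ x, |g x - c| ≤ |c| := fun x => by
    rw [show g x - c = c * (thickenedIndicator hδ0 F x - 1) by ring, abs_mul]
    refine mul_le_of_le_one_right (abs_nonneg _) (abs_le.2 ⟨?_, by linarith [hle x]⟩)
    linarith [(thickenedIndicator hδ0 F x).coe_nonneg]
  have hz : ∀ x ∉ Metric.cthickening δ F, g x = 0 := fun x hx => by
    have : thickenedIndicator hδ0 F x = 0 :=
      thickenedIndicator_zero hδ0 F fun h => hx (Metric.thickening_subset_cthickening _ _ h)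
    simp only [g, this]; simp
  have hL : IsLipB g := by
    refine IsLipB.const_mul c ⟨⟨_, (LipschitzWith.of_dist_le_mul (K := 1) fun a b => by simp [NNReal.dist_eq, Real.dist_eq] :
      LipschitzWith 1 ((↑) : ℝ≥0 → ℝ)).comp
      (lipschitzWith_thickenedIndicator hδ0 F)⟩, 1, fun x => ?_⟩
    rw [NNReal.abs_eq]; exact hle x
  have hmeas : MeasurableSet (Metric.cthickening δ F) := Metric.isClosed_cthickening.measurableSet
  have hgm : MemLp g 2 m := by
    refine (memLp_indicator_const 2 hmeas |c| (Or.inr hA)).mono hL.continuous.aestronglyMeasurable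
      (Eventually.of_forall fun x => ?_)
    by_cases hx : x ∈ Metric.cthickening δ F
    · simpa [hx] using hgb x
    · simp [hx, hz x hx]
  refine ⟨g, ⟨hL, hgm, ?_⟩, fun x hx => ?_, hgb, hgc, _, Metric.isClosed_cthickening, hz,
    Metric.self_subset_cthickening F, ?_⟩
  · obtain ⟨⟨K, hK⟩, -⟩ := id hL
    have : ∫⁻ x, slope g x ^ 2 ∂m ≤
        ∫⁻ x, (Metric.cthickening δ F).indicator (fun _ => (K : ℝ≥0∞) ^ 2) x ∂m := by
      refine lintegral_mono fun x => ?_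
      by_cases hx : x ∈ Metric.cthickening δ F
      · simp only [hx, indicator_of_mem]
        gcongr
        exact slope_le_of_lipschitzWith hK x
      · rw [slope_eq_zero_of_eventually_eq]
        · simp
        · filter_upwards [Metric.isClosed_cthickening.isOpen_compl.mem_nhds hx] with y hy
          rw [hz x hx, hz y hy]
    rw [lintegral_indicator hmeas, setLIntegral_const] at this
    unfold energy
    exact ENNReal.mul_ne_top (by simp) (ne_top_of_le_ne_top (by finiteness) this)
  · have : thickenedIndicator hδ0 F x = 1 := thickenedIndicator_one hδ0 F hx
    simp only [g, this]; simp
  · rw [measure_sdiff (Metric.self_subset_cthickening F) hF.measurableSet.nullMeasurableSet hmF]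
    exact tsub_le_iff_left.2 hδ.le

lemma exists_isFiniteEnergyLipB_eLpNorm_sub_indicator_le [IsLocallyFiniteMeasure m]
    [SecondCountableTopology X]
    (hm : ∀ (x : X) (r : ℝ), m (Metric.ball x r) < ∞) (c : ℝ) {s : Set X} (hs : MeasurableSet s)
    (hsm : m s < ∞) {ε : ℝ≥0∞} (hε : ε ≠ 0) :
    ∃ g : X → ℝ, eLpNorm (g - s.indicator fun _ => c) 2 m ≤ ε ∧ IsFiniteEnergyLipB m g := by
  obtain ⟨η, hη, hηs⟩ := exists_eLpNorm_indicator_le (μ := m) (p := 2) (by simp) |c| hε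
  -- Three errors share `η`: shrinking `s` to a closed set, cutting that down to a bounded one, and
  -- thickening the result.
  have hη3 : (η : ℝ≥0∞) / 3 ≠ 0 := (ENNReal.div_pos (by simpa using hη.ne') (by simp)).ne'
  obtain ⟨F₀, hF₀s, hF₀c, hF₀m⟩ := hs.exists_isClosed_sdiff_lt hsm.ne hη3
  obtain ⟨F, hFs, hFc, hFb, hFm⟩ : ∃ F ⊆ F₀, IsClosed F ∧ Bornology.IsBounded F ∧
      m (F₀ \ F) ≤ η / 3 := by
    rcases F₀.eq_empty_or_nonempty with rfl | ⟨o, ho⟩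
    · exact ⟨∅, subset_rfl, isClosed_empty, Bornology.isBounded_empty, by simp⟩
    have hF₀fin : m F₀ ≠ ∞ := ne_top_of_le_ne_top hsm.ne (measure_mono hF₀s)
    have hanti : Antitone fun n : ℕ => F₀ \ Metric.closedBall o n := fun i j hij =>
      sdiff_subset_sdiff_right (Metric.closedBall_subset_closedBall (by exact_mod_cast hij))
    have hlim := tendsto_measure_iInter_atTop (μ := m) (s := fun n : ℕ => F₀ \ Metric.closedBall o n)
      (fun n => (hF₀c.measurableSet.diff measurableSet_closedBall).nullMeasurableSet) hanti
      ⟨0, ne_top_of_le_ne_top hF₀fin (measure_mono sdiff_subset)⟩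
    have hempty : ⋂ n : ℕ, F₀ \ Metric.closedBall o n = ∅ := by
      ext x
      simp only [mem_iInter, Set.mem_sdiff, mem_empty_iff_false, iff_false]
      obtain ⟨n, hn⟩ := exists_nat_ge (dist x o)
      exact fun h => (h n).2 hn
    rw [hempty, measure_empty] at hlim
    obtain ⟨n, hn⟩ := (hlim.eventually (gt_mem_nhds (pos_iff_ne_zero.2 hη3))).exists
    refine ⟨F₀ ∩ Metric.closedBall o n, inter_subset_left, hF₀c.inter Metric.isClosed_closedBall,
      Metric.isBounded_closedBall.subset inter_subset_right, ?_⟩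
    rw [sdiff_self_inter]
    exact hn.le
  obtain ⟨g, hg, hgF, hgb, hgc, A, hAc, hgA, hFA, hAm⟩ :=
    exists_isFiniteEnergyLipB_of_isClosed hm hFc hFb c hη3
  refine ⟨g, ?_, hg⟩
  have hmeas : m ((A \ F) ∪ (s \ F)) ≤ η := by
    calc _ ≤ m (A \ F) + m (s \ F) := measure_union_le _ _
      _ ≤ m (A \ F) + (m (s \ F₀) + m (F₀ \ F)) := by
        gcongr
        refine (measure_mono ?_).trans (measure_union_le _ _)
        intro x hx
        by_cases h : x ∈ F₀
        · exact Or.inr ⟨h, hx.2⟩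
        · exact Or.inl ⟨hx.1, h⟩
      _ ≤ η / 3 + (η / 3 + η / 3) := by gcongr
      _ = _ := by rw [← add_assoc, ENNReal.add_thirds]
  refine le_trans (eLpNorm_mono_ae (Eventually.of_forall fun x => ?_)) (hηs _ hmeas)
  simp only [Pi.sub_apply, Real.norm_eq_abs]
  by_cases hxF : x ∈ F
  · simp [hgF x hxF, hF₀s (hFs hxF)]
  by_cases hxs : x ∈ s
  · have : x ∈ (A \ F) ∪ (s \ F) := Or.inr ⟨hxs, hxF⟩
    simp only [hxs, this, indicator_of_mem, abs_abs]
    exact hgc x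
  · by_cases hxA : x ∈ A
    · have : x ∈ (A \ F) ∪ (s \ F) := Or.inl ⟨hxA, hxF⟩
      simpa [hxs, this] using hgb x
    · simp [hxs, hgA x hxA]

theorem isConvexEnergy_cheeger [SecondCountableTopology X]
    (hm : ∀ (x : X) (r : ℝ), m (Metric.ball x r) < ∞) : IsConvexEnergy (cheeger m) where
  convex := cheeger_convex
  lsc := lowerSemicontinuous_cheeger
  zero := cheeger_zero
  dense := by
    have : IsLocallyFiniteMeasure m :=
      ⟨fun x => ⟨Metric.ball x 1, Metric.ball_mem_nhds x one_pos, hm x 1⟩⟩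
    intro f
    refine EMetric.mem_closure_iff.2 fun ε hε => ?_
    obtain ⟨g, hg1, hg2⟩ := (Lp.memLp f).induction_dense (p := 2) (by simp)
      (IsFiniteEnergyLipB m)
      (fun c s hs hsm ε hε => exists_isFiniteEnergyLipB_eLpNorm_sub_indicator_le hm c hs hsm hε)
      (fun _ _ => IsFiniteEnergyLipB.add) (fun g hg => hg.2.1.1) (ENNReal.half_pos hε.ne').ne'
    refine ⟨hg2.2.1.toLp g, hg2.cheeger_ne_top, ?_⟩
    rw [Lp.edist_def]
    -- Half of `∞` is not strictly smaller than `∞`.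
    by_cases hεt : ε = ∞
    · rw [hεt]
      have := ((Lp.memLp f).sub (Lp.memLp (hg2.2.1.toLp g))).2
      exact this
    refine lt_of_le_of_lt (le_trans (le_of_eq ?_) hg1) (ENNReal.half_lt_self hε.ne' hεt)
    refine eLpNorm_congr_ae ?_
    filter_upwards [hg2.2.1.coeFn_toLp] with x hx
    simp [hx]

end Density

/-! ### Absolutely continuous curves -/

section AbsolutelyContinuous

lemma le_of_deriv_nonpos_of_absolutelyContinuous {f : ℝ → ℝ} {a b : ℝ} (hab : a ≤ b)
    (hf : AbsolutelyContinuousOnInterval f a b)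
    (h : ∀ᵐ t ∂(volume.restrict (Icc a b)), deriv f t ≤ 0) : f b ≤ f a := by
  have h1 := hf.integral_deriv_eq_sub
  have h2 : ∫ t in a..b, deriv f t ≤ ∫ _ in a..b, (0 : ℝ) :=
    intervalIntegral.integral_mono_ae_restrict hab hf.intervalIntegrable_deriv
      intervalIntegrable_const h
  simp only [intervalIntegral.integral_zero] at h2
  linarith

lemma absolutelyContinuousOnInterval_of_dist_le {E F : Type*} [PseudoMetricSpace E]
    [PseudoMetricSpace F] {f : ℝ → E} {g : ℝ → F} {a b : ℝ}
    (hf : AbsolutelyContinuousOnInterval f a b) (L : ℝ)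
    (h : ∀ s ∈ uIcc a b, ∀ t ∈ uIcc a b, dist (g s) (g t) ≤ L * dist (f s) (f t)) :
    AbsolutelyContinuousOnInterval g a b := by
  unfold AbsolutelyContinuousOnInterval at hf ⊢
  refine squeeze_zero' (Eventually.of_forall fun _ => Finset.sum_nonneg fun _ _ => dist_nonneg) ?_
    (by simpa using hf.const_mul L)
  rw [eventually_inf_principal]
  filter_upwards with (n, I) hnI
  rw [Finset.mul_sum]
  refine Finset.sum_le_sum fun i hi => ?_
  simp only [AbsolutelyContinuousOnInterval.disjWithin, mem_ofPred_eq] at hnI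
  exact h _ (hnI.left i hi).1 _ (hnI.left i hi).2

end AbsolutelyContinuous

/-! ### Differentiability of `w ↦ ∫ Ψ(w)` on `L²` -/

section Functionals

/-- `Ψ` is a primitive, vanishing at `0`, of a differentiable `ψ` with `0 ≤ ψ' ≤ 1`, `ψ 0 = 0`. -/
structure IsContractionPrimitive (Ψ ψ : ℝ → ℝ) : Prop where
  hasDerivAt : ∀ s, HasDerivAt Ψ (ψ s) s
  zero : Ψ 0 = 0
  lipschitz : LipschitzWith 1 ψ
  deriv_zero : ψ 0 = 0
  deriv_mem : ∀ s, ∃ c, 0 ≤ c ∧ c ≤ 1 ∧ HasDerivAt ψ c s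

variable {Ψ ψ : ℝ → ℝ}

lemma IsContractionPrimitive.continuous (h : IsContractionPrimitive Ψ ψ) : Continuous Ψ :=
  continuous_iff_continuousAt.2 fun s => (h.hasDerivAt s).continuousAt

lemma IsContractionPrimitive.taylor (h : IsContractionPrimitive Ψ ψ) (a b : ℝ) :
    |Ψ b - Ψ a - ψ a * (b - a)| ≤ (b - a) ^ 2 := by
  have h1 := (convex_uIcc a b).norm_image_sub_le_of_norm_hasDerivWithin_le
    (f := fun s => Ψ s - ψ a * s) (f' := fun s => ψ s - ψ a) (C := |b - a|)
    (x := a) (y := b)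
    (fun s _ => ((h.hasDerivAt s).fun_sub (hasDerivAt_const_mul (ψ a))).hasDerivWithinAt)
    (fun s hs => by
      have h2 := h.lipschitz.dist_le_mul s a
      rw [NNReal.coe_one, one_mul, Real.dist_eq, Real.dist_eq] at h2
      exact h2.trans (abs_sub_left_of_mem_uIcc hs)) left_mem_uIcc right_mem_uIcc
  rw [Real.norm_eq_abs, Real.norm_eq_abs, abs_mul_abs_self] at h1
  rw [show Ψ b - Ψ a - ψ a * (b - a) = Ψ b - ψ a * b - (Ψ a - ψ a * a) by ring]
  linarith

variable {α : Type*} [MeasurableSpace α] {μ : Measure α}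

lemma sq_integrable_Lp (w : Lp ℝ 2 μ) : Integrable (fun x => w x ^ 2) μ :=
  (Lp.memLp w).integrable_sq

lemma integral_sq_Lp (w : Lp ℝ 2 μ) : ∫ x, w x ^ 2 ∂μ = ‖w‖ ^ 2 := by
  rw [← real_inner_self_eq_norm_sq, L2.inner_def]
  refine integral_congr_ae (Eventually.of_forall fun x => ?_)
  simp [pow_two]

lemma IsContractionPrimitive.integrable (h : IsContractionPrimitive Ψ ψ) (w : Lp ℝ 2 μ) :
    Integrable (fun x => Ψ (w x)) μ := by
  refine (sq_integrable_Lp w).mono' (h.continuous.comp_aestronglyMeasurable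
    (Lp.aestronglyMeasurable w)) (Eventually.of_forall fun x => ?_)
  have := h.taylor 0 (w x)
  simpa [h.zero, h.deriv_zero] using this

lemma IsContractionPrimitive.abs_integral_sub_le (h : IsContractionPrimitive Ψ ψ)
    (w z : Lp ℝ 2 μ) :
    |∫ x, Ψ (z x) ∂μ - ∫ x, Ψ (w x) ∂μ - inner ℝ (h.lipschitz.compLp h.deriv_zero w) (z - w)| ≤
      ‖z - w‖ ^ 2 := by
  rw [← integral_sq_Lp, L2.inner_def, ← integral_sub (h.integrable z) (h.integrable w),
    ← integral_sub (f := fun x => Ψ (z x) - Ψ (w x)) ((h.integrable z).sub (h.integrable w))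
      (L2.integrable_inner _ _)]
  refine abs_integral_le_integral_abs.trans (integral_mono_ae ?_ (sq_integrable_Lp _) ?_)
  · exact (((h.integrable z).sub (h.integrable w)).sub (L2.integrable_inner _ _)).abs
  · filter_upwards [h.lipschitz.coeFn_compLp h.deriv_zero w, Lp.coeFn_sub z w] with x e1 e2
    have := h.taylor (w x) (z x)
    simp only [e1, e2, Pi.sub_apply, Function.comp_apply]
    simpa [mul_comm] using this

/-- The pointwise Taylor remainder is at most the square of the increment, uniformly in the base
point, so it integrates to `‖z - w‖²`. -/
lemma IsContractionPrimitive.hasFDerivAt (h : IsContractionPrimitive Ψ ψ) (w : Lp ℝ 2 μ) :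
    HasFDerivAt (fun z : Lp ℝ 2 μ => ∫ x, Ψ (z x) ∂μ)
      (innerSL ℝ (h.lipschitz.compLp h.deriv_zero w)) w := by
  rw [hasFDerivAt_iff_isLittleO]
  have h1 : (fun z : Lp ℝ 2 μ => ∫ x, Ψ (z x) ∂μ - ∫ x, Ψ (w x) ∂μ -
      innerSL ℝ (h.lipschitz.compLp h.deriv_zero w) (z - w)) =O[𝓝 w] fun z => ‖z - w‖ ^ 2 :=
    Asymptotics.IsBigO.of_bound 1 (Eventually.of_forall fun z => by
      simpa using h.abs_integral_sub_le w z)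
  refine h1.trans_isLittleO ?_
  have h2 : (fun v : Lp ℝ 2 μ => ‖v‖ ^ 2) =o[𝓝 0] fun v => v :=
    Asymptotics.isLittleO_norm_pow_id one_lt_two
  have h3 : Tendsto (fun z => z - w) (𝓝 w) (𝓝 0) := by
    have : Tendsto (fun z => z - w) (𝓝 w) (𝓝 (w - w)) := (continuous_sub_right w).tendsto w
    rwa [sub_self] at this
  exact h2.comp_tendsto h3

lemma IsContractionPrimitive.abs_integral_sub_le_mul (h : IsContractionPrimitive Ψ ψ)
    {w z : Lp ℝ 2 μ} {C : ℝ} (hw : ‖w‖ ≤ C) (hz : ‖z‖ ≤ C) :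
    |∫ x, Ψ (z x) ∂μ - ∫ x, Ψ (w x) ∂μ| ≤ 3 * C * ‖z - w‖ := by
  have h1 := h.abs_integral_sub_le w z
  have h2 := abs_real_inner_le_norm (h.lipschitz.compLp h.deriv_zero w) (z - w)
  have h3 : ‖h.lipschitz.compLp h.deriv_zero w‖ ≤ ‖w‖ := by
    simpa using h.lipschitz.norm_compLp_le h.deriv_zero w
  have h4 : ‖z - w‖ ≤ 2 * C := (norm_sub_le _ _).trans (by linarith)
  have h5 := abs_sub_abs_le_abs_sub (∫ x, Ψ (z x) ∂μ - ∫ x, Ψ (w x) ∂μ)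
    (inner ℝ (h.lipschitz.compLp h.deriv_zero w) (z - w))
  nlinarith [norm_nonneg (z - w), mul_le_mul_of_nonneg_right (h3.trans hw) (norm_nonneg (z - w)),
    mul_le_mul_of_nonneg_right h4 (norm_nonneg (z - w))]

end Functionals

/-! ### Monotone functionals of two flows, uniqueness, homogeneity -/

section Contraction

variable {X : Type*} [MetricSpace X] [MeasurableSpace X] {m : Measure X}

variable [BorelSpace X]

/-- With `w = ψ(f - g)`, the subgradient `l` is tested at `f - w` and `k` at `g + w`; the exchange
inequality makes the sum of the energy increments nonpositive. -/
lemma inner_subdifferential_contraction_nonneg {f g l k : Lp ℝ 2 m}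
    (hl : l ∈ cheegerSubdifferential m f) (hk : k ∈ cheegerSubdifferential m g) {ψ : ℝ → ℝ}
    (hψl : LipschitzWith 1 ψ) (hψ0 : ψ 0 = 0)
    (hψ : ∀ s, ∃ c, 0 ≤ c ∧ c ≤ 1 ∧ HasDerivAt ψ c s) :
    0 ≤ inner ℝ (hψl.compLp hψ0 (f - g)) (l - k) := by
  have h := cheeger_contraction_add_le f g hψl hψ0 hψ
  set w := hψl.compLp hψ0 (f - g)
  have hfin : cheeger m (f - w) + cheeger m (g + w) ≠ ∞ :=
    ne_top_of_le_ne_top (ENNReal.add_ne_top.2 ⟨hl.1, hk.1⟩) h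
  obtain ⟨hf1, hf2⟩ := ENNReal.add_ne_top.1 hfin
  have h1 := hl.2 _ hf1
  have h2 := hk.2 _ hf2
  have h3 := ENNReal.toReal_mono (ENNReal.add_ne_top.2 ⟨hl.1, hk.1⟩) h
  rw [ENNReal.toReal_add hf1 hf2, ENNReal.toReal_add hl.1 hk.1] at h3
  rw [sub_sub_cancel_left, inner_neg_right] at h1
  rw [add_sub_cancel_left] at h2
  rw [real_inner_comm, inner_sub_left]
  linarith

/-- The derivative of `∫ Ψ(u - v)` is `∫ ψ(u - v)(u' - v') ≤ 0`. Absolute continuity is known only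
on compact subintervals of `(0, ∞)`, so time `0` is reached by continuity. -/
theorem integral_heatFlow_sub_le {f g : Lp ℝ 2 m} {u v : ℝ → Lp ℝ 2 m}
    (hu : IsL2HeatFlow m f u) (hv : IsL2HeatFlow m g v) {Ψ ψ : ℝ → ℝ}
    (h : IsContractionPrimitive Ψ ψ) {t : ℝ} (ht : 0 ≤ t) :
    ∫ x, Ψ ((u t - v t : Lp ℝ 2 m) x) ∂m ≤ ∫ x, Ψ ((f - g : Lp ℝ 2 m) x) ∂m := by
  rcases ht.eq_or_lt with rfl | ht
  · rw [hu.initial, hv.initial]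
  let E : Lp ℝ 2 m → ℝ := fun w => ∫ x, Ψ (w x) ∂m
  have hmono : ∀ s, 0 < s → s ≤ t → E (u t - v t) ≤ E (u s - v s) := by
    intro s hs hst
    have hac : AbsolutelyContinuousOnInterval (fun r => u r - v r) s t :=
      (hu.absolutelyContinuous s t hs hst).fun_sub (hv.absolutelyContinuous s t hs hst)
    obtain ⟨C, hC⟩ := hac.exists_bound
    have hacE : AbsolutelyContinuousOnInterval (fun r => E (u r - v r)) s t :=
      absolutelyContinuousOnInterval_of_dist_le hac (3 * C) fun a ha b hb => by
        rw [Real.dist_eq, dist_eq_norm]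
        exact h.abs_integral_sub_le_mul (hC b hb) (hC a ha)
    refine le_of_deriv_nonpos_of_absolutelyContinuous hst hacE ?_
    have hsub : Icc s t ⊆ Ioi 0 := fun r hr => hs.trans_le hr.1
    filter_upwards [ae_mono (Measure.restrict_mono_set volume hsub) hu.deriv_mem,
      ae_mono (Measure.restrict_mono_set volume hsub) hv.deriv_mem]
      with r ⟨w₁, hw₁, hm₁⟩ ⟨w₂, hw₂, hm₂⟩
    have hd := (h.hasFDerivAt (u r - v r)).comp_hasDerivAt r (hw₁.sub hw₂)
    have hd' : HasDerivAt (fun r => E (u r - v r)) _ r := hd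
    rw [hd'.deriv]
    have := inner_subdifferential_contraction_nonneg hm₁ hm₂ h.lipschitz h.deriv_zero h.deriv_mem
    rw [innerSL_apply_apply]
    rw [show -w₁ - -w₂ = -(w₁ - w₂) by abel, inner_neg_right] at this
    linarith
  have hcont : Tendsto (fun s => E (u s - v s)) (𝓝[>] 0) (𝓝 (E (f - g))) :=
    ((h.hasFDerivAt (f - g)).continuousAt.tendsto).comp
      (hu.tendsto_initial.sub hv.tendsto_initial)
  refine ge_of_tendsto hcont ?_
  filter_upwards [Ioo_mem_nhdsGT ht] with s hs
  exact hmono s hs.1 hs.2.le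

lemma isContractionPrimitive_sq : IsContractionPrimitive (fun s => s ^ 2 / 2) (fun s => s) where
  hasDerivAt s := by
    have := (hasDerivAt_pow 2 s).div_const 2
    simpa using this
  zero := by norm_num
  lipschitz := LipschitzWith.id
  deriv_zero := rfl
  deriv_mem s := ⟨1, zero_le_one, le_rfl, hasDerivAt_id s⟩

theorem IsL2HeatFlow.unique {f : Lp ℝ 2 m} {u v : ℝ → Lp ℝ 2 m}
    (hu : IsL2HeatFlow m f u) (hv : IsL2HeatFlow m f v) {t : ℝ} (ht : 0 ≤ t) : u t = v t := by
  have h := integral_heatFlow_sub_le hu hv isContractionPrimitive_sq ht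
  rw [integral_div, integral_div, integral_sq_Lp, integral_sq_Lp, sub_self] at h
  rw [← sub_eq_zero, ← norm_eq_zero]
  have : ‖u t - v t‖ ^ 2 ≤ 0 := by
    rw [norm_zero] at h
    linarith
  exact pow_eq_zero_iff two_ne_zero |>.1 (le_antisymm this (sq_nonneg _))

/-- The quadratic bound makes the derivative at the junction zero. It serves for `smoothPosPart` and
again for its derivative. -/
lemma hasDerivAt_ite_pos {p p' : ℝ → ℝ} {C : ℝ} (hp : ∀ s > 0, HasDerivAt p (p' s) s)
    (hC : ∀ s > 0, |p s| ≤ C * s ^ 2) (s : ℝ) :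
    HasDerivAt (fun s => if 0 < s then p s else 0) (if 0 < s then p' s else 0) s := by
  rcases lt_trichotomy s 0 with hs | rfl | hs
  · rw [if_neg (not_lt.2 hs.le)]
    refine (hasDerivAt_const s (0 : ℝ)).congr_of_eventuallyEq ?_
    filter_upwards [gt_mem_nhds hs] with r hr
    rw [if_neg (not_lt.2 hr.le)]
  · rw [if_neg (lt_irrefl _), hasDerivAt_iff_isLittleO]
    have h1 : (fun x : ℝ => (if 0 < x then p x else 0) - (if (0 : ℝ) < 0 then p 0 else 0) -
        (x - 0) • (0 : ℝ)) =O[𝓝 0] fun x => ‖x‖ ^ 2 :=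
      Asymptotics.IsBigO.of_bound |C| (Eventually.of_forall fun x => by
        split_ifs with hx h0
        · exact absurd h0 (lt_irrefl _)
        · simp only [sub_zero, smul_zero, Real.norm_eq_abs, sq_abs, abs_pow]
          exact (hC x hx).trans (by gcongr; exact le_abs_self C)
        · exact absurd ‹(0 : ℝ) < 0› (lt_irrefl _)
        · simp; positivity)
    refine h1.trans_isLittleO ?_
    simpa using Asymptotics.isLittleO_norm_pow_id (E' := ℝ) one_lt_two
  · rw [if_pos hs]
    refine (hp s hs).congr_of_eventuallyEq ?_
    filter_upwards [lt_mem_nhds hs] with r hr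
    rw [if_pos hr]

/-- A smooth approximation (from below, as `ε → 0`) of the positive part, up to the factor
`ε / 2`. -/
def smoothPosPart (ε s : ℝ) : ℝ := if 0 < s then ε / 2 * (s ^ 3 / (s + ε) ^ 2) else 0

lemma isContractionPrimitive_smoothPosPart {ε : ℝ} (hε : 0 < ε) :
    IsContractionPrimitive (smoothPosPart ε)
      (fun s => if 0 < s then ε / 2 * (3 * (s / (s + ε)) ^ 2 - 2 * (s / (s + ε)) ^ 3) else 0) := by
  have ht : ∀ s > 0, 0 < s / (s + ε) ∧ s / (s + ε) < 1 := fun s hs =>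
    ⟨by positivity, by rw [div_lt_one (by positivity)]; linarith⟩
  have hts : ∀ s > 0, s / (s + ε) ≤ s / ε := fun s hs => by gcongr; linarith
  have h1 : ∀ s, HasDerivAt (smoothPosPart ε)
      (if 0 < s then ε / 2 * (3 * (s / (s + ε)) ^ 2 - 2 * (s / (s + ε)) ^ 3) else 0) s := by
    refine hasDerivAt_ite_pos (C := 1) (fun s hs => ?_) fun s hs => ?_
    · have hne : s + ε ≠ 0 := by positivity
      have := (((hasDerivAt_pow 3 s).div (((hasDerivAt_id s).add_const ε).pow 2)
        (by simpa using hne))).const_mul (ε / 2)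
      convert! this using 1
      simp
      left
      field_simp
    · have hs0 : 0 < s := hs
      rw [abs_of_nonneg (by positivity), one_mul, ← mul_div_assoc, div_le_iff₀ (by positivity)]
      nlinarith [mul_pos (pow_pos hs0 2) (pow_pos hs0 2), mul_pos (pow_pos hs0 3) hε,
        mul_pos (pow_pos hs0 2) (pow_pos hε 2)]
  have h2 : ∀ s, HasDerivAt
      (fun s => if 0 < s then ε / 2 * (3 * (s / (s + ε)) ^ 2 - 2 * (s / (s + ε)) ^ 3) else 0)
      (if 0 < s then 3 * (s / (s + ε)) * (1 - s / (s + ε)) ^ 3 else 0) s := by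
    -- With `r = s / (s + ε) ≤ s / ε`, the function is at most `(ε / 2) * 3 r²`. As `dr/ds = (1 -
    -- r)² / ε`, its derivative is `3 r (1 - r)³`, which is at most `3 r (1 - r) ≤ 3 / 4`.
    refine hasDerivAt_ite_pos (C := 3 / (2 * ε)) (fun s hs => ?_) fun s hs => ?_
    · have hne : s + ε ≠ 0 := by positivity
      have hd := ((hasDerivAt_id s).div ((hasDerivAt_id s).add_const ε) (by simpa using hne))
      have := (((hd.pow 2).const_mul 3).sub ((hd.pow 3).const_mul 2)).const_mul (ε / 2)
      convert! this using 1
      simp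
      field_simp
      ring
    · obtain ⟨a1, a2⟩ := ht s hs
      have a3 := hts s hs
      set r := s / (s + ε)
      have a4 : r ^ 2 ≤ (s / ε) ^ 2 := by gcongr
      have a5 : 0 < r ^ 2 := by positivity
      have a6 : r ^ 3 ≤ r ^ 2 := pow_le_pow_of_le_one a1.le a2.le (by norm_num)
      have a7 : 0 < r ^ 3 := by positivity
      rw [abs_of_nonneg (mul_nonneg (by positivity) (by linarith))]
      calc _ ≤ ε / 2 * (3 * (s / ε) ^ 2) := by gcongr; linarith
        _ = _ := by field_simp
  have h3 : ∀ s, 0 ≤ (if 0 < s then 3 * (s / (s + ε)) * (1 - s / (s + ε)) ^ 3 else 0) ∧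
      (if 0 < s then 3 * (s / (s + ε)) * (1 - s / (s + ε)) ^ 3 else 0) ≤ 1 := by
    intro s
    split_ifs with hs
    · obtain ⟨a1, a2⟩ := ht s hs
      set r := s / (s + ε)
      have b1 : 0 ≤ 1 - r := by linarith
      refine ⟨by positivity, ?_⟩
      have b2 : (1 - r) ^ 3 ≤ 1 - r := pow_le_of_le_one b1 (by linarith) (by norm_num)
      have b3 : r * (1 - r) ^ 3 ≤ r * (1 - r) := by gcongr
      nlinarith [sq_nonneg (r - 1 / 2)]
    · exact ⟨le_rfl, zero_le_one⟩
  refine ⟨h1, by simp [smoothPosPart], ?_, by simp, fun s => ⟨_, (h3 s).1, (h3 s).2, h2 s⟩⟩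
  refine lipschitzWith_of_nnnorm_deriv_le (fun s => (h2 s).differentiableAt) fun s => ?_
  rw [(h2 s).deriv, ← NNReal.coe_le_coe, coe_nnnorm, Real.norm_eq_abs, abs_of_nonneg (h3 s).1]
  exact (h3 s).2

lemma smoothPosPart_nonneg {ε : ℝ} (hε : 0 < ε) (s : ℝ) : 0 ≤ smoothPosPart ε s := by
  unfold smoothPosPart
  split_ifs
  · positivity
  · rfl

lemma smoothPosPart_le {ε : ℝ} (hε : 0 < ε) (s : ℝ) :
    ENNReal.ofReal (2 / ε * smoothPosPart ε s) ≤ ENNReal.ofReal s := by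
  unfold smoothPosPart
  split_ifs with hs
  · refine ENNReal.ofReal_le_ofReal ?_
    rw [← mul_assoc, show 2 / ε * (ε / 2) = 1 by field_simp, one_mul,
      div_le_iff₀ (by positivity)]
    nlinarith [mul_pos hs hε, mul_pos hs hs, mul_pos (mul_pos hs hs) hε, mul_pos hs (mul_pos hε hε)]
  · simp

lemma tendsto_smoothPosPart (s : ℝ) :
    Tendsto (fun n : ℕ => ENNReal.ofReal (2 / (1 / ((n : ℝ) + 1)) *
      smoothPosPart (1 / ((n : ℝ) + 1)) s)) atTop (𝓝 (ENNReal.ofReal s)) := by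
  unfold smoothPosPart
  split_ifs with hs
  · refine ENNReal.tendsto_ofReal ?_
    have h1 : Tendsto (fun n : ℕ => s ^ 3 / (s + 1 / ((n : ℝ) + 1)) ^ 2) atTop
        (𝓝 (s ^ 3 / (s + 0) ^ 2)) :=
      tendsto_const_nhds.div ((tendsto_one_div_add_atTop_nhds_zero_nat.const_add s).pow 2)
        (by simpa using hs.ne')
    rw [show s ^ 3 / (s + 0) ^ 2 = s by rw [add_zero]; field_simp] at h1
    refine h1.congr fun n => ?_
    have : (n : ℝ) + 1 ≠ 0 := by positivity
    field_simp
  · simp [ENNReal.ofReal_of_nonpos (not_lt.1 hs)]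

/-- The positive part of the difference of two heat flows has decreasing integral. -/
theorem lintegral_heatFlow_sub_le {f g : Lp ℝ 2 m} {u v : ℝ → Lp ℝ 2 m}
    (hu : IsL2HeatFlow m f u) (hv : IsL2HeatFlow m g v) {t : ℝ} (ht : 0 ≤ t) :
    ∫⁻ x, ENNReal.ofReal (u t x - v t x) ∂m ≤ ∫⁻ x, ENNReal.ofReal (f x - g x) ∂m := by
  let Θ : ℕ → ℝ → ℝ≥0∞ := fun n s => ENNReal.ofReal (2 / (1 / ((n : ℝ) + 1)) *
      smoothPosPart (1 / ((n : ℝ) + 1)) s)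
  have hΘm : ∀ n, Measurable (Θ n) := fun n => by
    refine ENNReal.measurable_ofReal.comp (Measurable.const_mul ?_ _)
    exact (isContractionPrimitive_smoothPosPart Nat.one_div_pos_of_nat).continuous.measurable
  -- Since `Θ n s ≤ s₊`, the right side already has its final form; only the left side needs a
  -- limit, for which Fatou suffices.
  have hcomp : ∀ n, ∫⁻ x, Θ n ((u t - v t : Lp ℝ 2 m) x) ∂m ≤
      ∫⁻ x, ENNReal.ofReal ((f - g : Lp ℝ 2 m) x) ∂m := by
    intro n
    have hn : 0 < 1 / ((n : ℝ) + 1) := Nat.one_div_pos_of_nat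
    have hP := isContractionPrimitive_smoothPosPart hn
    have h1 := integral_heatFlow_sub_le hu hv hP ht
    have e : ∀ w : Lp ℝ 2 m, ∫⁻ x, Θ n (w x) ∂m =
        ENNReal.ofReal (2 / (1 / ((n : ℝ) + 1)) * ∫ x, smoothPosPart (1 / ((n : ℝ) + 1)) (w x) ∂m) := by
      intro w
      rw [← integral_const_mul, ofReal_integral_eq_lintegral_ofReal ((hP.integrable w).const_mul _)
        (Eventually.of_forall fun x => mul_nonneg (by positivity) (smoothPosPart_nonneg hn _))]
    calc _ ≤ ∫⁻ x, Θ n ((f - g : Lp ℝ 2 m) x) ∂m := by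
          rw [e, e]
          exact ENNReal.ofReal_le_ofReal (mul_le_mul_of_nonneg_left h1 (by positivity))
      _ ≤ _ := lintegral_mono fun x => smoothPosPart_le hn _
  have e1 : ∫⁻ x, ENNReal.ofReal (u t x - v t x) ∂m =
      ∫⁻ x, liminf (fun n => Θ n ((u t - v t : Lp ℝ 2 m) x)) atTop ∂m := by
    refine lintegral_congr_ae ?_
    filter_upwards [Lp.coeFn_sub (u t) (v t)] with x hx
    rw [(tendsto_smoothPosPart _).liminf_eq, hx, Pi.sub_apply]
  have e2 : ∫⁻ x, ENNReal.ofReal (f x - g x) ∂m =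
      ∫⁻ x, ENNReal.ofReal ((f - g : Lp ℝ 2 m) x) ∂m := by
    refine lintegral_congr_ae ?_
    filter_upwards [Lp.coeFn_sub f g] with x hx
    rw [hx, Pi.sub_apply]
  rw [e1, e2]
  refine (lintegral_liminf_le' fun n => (hΘm n).comp_aemeasurable
    (Lp.aestronglyMeasurable _).aemeasurable).trans ?_
  exact liminf_le_of_le (h := fun b hb => by
    obtain ⟨n, hn⟩ := hb.exists
    exact hn.trans (hcomp n))

lemma cheegerSubdifferential_smul {c : ℝ} (hc : 0 < c) {f l : Lp ℝ 2 m}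
    (hl : l ∈ cheegerSubdifferential m f) : c • l ∈ cheegerSubdifferential m (c • f) := by
  refine ⟨by rw [cheeger_const_smul hc]; exact ENNReal.mul_ne_top ENNReal.ofReal_ne_top hl.1,
    fun g hg => ?_⟩
  have e : g = c • (c⁻¹ • g) := by rw [smul_smul, mul_inv_cancel₀ hc.ne', one_smul]
  have hg' : cheeger m (c⁻¹ • g) ≠ ∞ := by
    rw [cheeger_const_smul (inv_pos.2 hc)]; exact ENNReal.mul_ne_top ENNReal.ofReal_ne_top hg
  have h := hl.2 _ hg'
  rw [e, cheeger_const_smul hc, cheeger_const_smul hc, ← smul_sub, inner_smul_left,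
    inner_smul_right, ENNReal.toReal_mul, ENNReal.toReal_mul, ENNReal.toReal_ofReal (by positivity),
    conj_trivial, ← mul_sub, ← mul_assoc, ← pow_two]
  gcongr

/-- Positive homogeneity of the flow, a substitute for linearity: `∂Ch` is 1-homogeneous because
`Ch` is 2-homogeneous. -/
theorem IsL2HeatFlow.smul {f : Lp ℝ 2 m} {u : ℝ → Lp ℝ 2 m} (hu : IsL2HeatFlow m f u)
    {c : ℝ} (hc : 0 < c) : IsL2HeatFlow m (c • f) fun t => c • u t where
  initial := by rw [hu.initial]
  tendsto_initial := hu.tendsto_initial.const_smul c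
  absolutelyContinuous a b ha hab := (hu.absolutelyContinuous a b ha hab).const_smul c
  deriv_mem := by
    filter_upwards [hu.deriv_mem] with t ⟨w, hw, hm⟩
    refine ⟨c • w, hw.const_smul c, ?_⟩
    rw [← smul_neg]
    exact cheegerSubdifferential_smul hc hm

theorem isL2HeatFlow_zero : IsL2HeatFlow m 0 fun _ => (0 : Lp ℝ 2 m) where
  initial := rfl
  tendsto_initial := tendsto_const_nhds
  absolutelyContinuous a b _ _ :=
    (LipschitzWith.const (0 : Lp ℝ 2 m)).lipschitzOnWith.absolutelyContinuousOnInterval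
  deriv_mem := Eventually.of_forall fun t => ⟨0, hasDerivAt_const t _,
    by simp [cheeger_zero], fun g _ => by simp [cheeger_zero]⟩

end Contraction

/-! ### The Hellinger integrand as a superposition of positive parts -/

section HellingerKernel

/-- The weight in the representation of the Hellinger integrand by positive parts. -/
def hellingerWeight (p r : ℝ) : ℝ := (1 - r ^ (p - 1)⁻¹) ^ (-p)

lemma measurable_hellingerWeight (p : ℝ) : Measurable (hellingerWeight p) := by
  unfold hellingerWeight; fun_prop

lemma one_le_hellingerWeight {p : ℝ} (hp : 1 < p) {r : ℝ} (hr : r ∈ Ioo (0 : ℝ) 1) :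
    1 ≤ hellingerWeight p r := by
  have h1 : r ^ (p - 1)⁻¹ < 1 := Real.rpow_lt_one hr.1.le hr.2 (inv_pos.2 (by linarith))
  have h2 : 0 < r ^ (p - 1)⁻¹ := Real.rpow_pos_of_pos hr.1 _
  exact Real.one_le_rpow_of_pos_of_le_one_of_nonpos (by linarith) (by linarith) (by linarith)

/-- This dictates the form of the weight: the set of `r` with `λ(r) b < τ` has length `(1 -
(b/τ)^{1/p})^{p-1}`, which is the `τ`-derivative of `(τ^{1/p} - b^{1/p})^p`. -/
lemma hellingerWeight_mul_lt_iff {p : ℝ} (hp : 1 < p) {r b τ : ℝ} (hr : r ∈ Ioo (0 : ℝ) 1)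
    (hb : 0 < b) (hτ : b ≤ τ) :
    hellingerWeight p r * b < τ ↔ r < (1 - (b / τ) ^ p⁻¹) ^ (p - 1) := by
  have hτ0 : 0 < τ := hb.trans_le hτ
  have h1 : r ^ (p - 1)⁻¹ < 1 := Real.rpow_lt_one hr.1.le hr.2 (inv_pos.2 (by linarith))
  have h2 : (b / τ) ^ p⁻¹ ≤ 1 :=
    Real.rpow_le_one (by positivity) ((div_le_one hτ0).2 hτ) (inv_pos.2 (by linarith)).le
  have hs : 0 < 1 - r ^ (p - 1)⁻¹ := by linarith
  unfold hellingerWeight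
  rw [Real.rpow_neg hs.le, inv_mul_lt_iff₀ (Real.rpow_pos_of_pos hs _), ← div_lt_iff₀ hτ0,
    ← Real.rpow_inv_lt_iff_of_pos (by positivity) hs.le (by linarith), lt_sub_comm,
    Real.rpow_inv_lt_iff_of_pos hr.1.le (by linarith) (by linarith)]

lemma integral_hellinger_density {p : ℝ} (hp : 1 < p) {a b : ℝ} (hb : 0 < b) (hab : b ≤ a) :
    ∫ τ in b..a, (1 - (b / τ) ^ p⁻¹) ^ (p - 1) = (a ^ p⁻¹ - b ^ p⁻¹) ^ p := by
  have hp0 : p ≠ 0 := by linarith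
  have h := intervalIntegral.integral_eq_sub_of_hasDerivAt_of_le hab
    (f := fun τ => (τ ^ p⁻¹ - b ^ p⁻¹) ^ p) (f' := fun τ => (1 - (b / τ) ^ p⁻¹) ^ (p - 1)) ?_ ?_ ?_
  · rw [h, sub_self, Real.zero_rpow hp0, sub_zero]
  · refine ContinuousOn.rpow_const ?_ fun x _ => Or.inr (by linarith)
    exact ((continuousOn_id.rpow_const fun x _ => Or.inr (by positivity)).sub continuousOn_const)
  · intro τ hτ
    have hτ0 : 0 < τ := hb.trans hτ.1
    have hpos : 0 < τ ^ p⁻¹ - b ^ p⁻¹ :=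
      sub_pos.2 (Real.rpow_lt_rpow hb.le hτ.1 (inv_pos.2 (by linarith)))
    have hd := (((Real.hasDerivAt_rpow_const (p := p⁻¹) (Or.inl hτ0.ne')).sub_const
      (b ^ p⁻¹)).rpow_const (p := p) (Or.inl hpos.ne'))
    convert! hd using 1
    have e1 : 1 - (b / τ) ^ p⁻¹ = (τ ^ p⁻¹ - b ^ p⁻¹) * (τ ^ p⁻¹)⁻¹ := by
      rw [Real.div_rpow hb.le hτ0.le]
      have : τ ^ p⁻¹ ≠ 0 := (Real.rpow_pos_of_pos hτ0 _).ne'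
      field_simp
    rw [e1, Real.mul_rpow hpos.le (by positivity), ← Real.rpow_neg hτ0.le, ← Real.rpow_mul hτ0.le,
      show -p⁻¹ * (p - 1) = p⁻¹ - 1 by field_simp; ring]
    field_simp
  · refine ContinuousOn.intervalIntegrable_of_Icc hab ?_
    refine ContinuousOn.rpow_const (continuousOn_const.sub ?_) fun x _ => Or.inr (by linarith)
    refine ContinuousOn.rpow_const ?_ fun x _ => Or.inr (by positivity)
    exact continuousOn_const.div continuousOn_id fun x hx => (hb.trans_le hx.1).ne'

/-- The positive Hellinger integrand is a superposition of positive parts `(a - λ b)₊`. -/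
lemma lintegral_hellingerWeight {p : ℝ} (hp : 1 < p) {a b : ℝ} (ha : 0 ≤ a) (hb : 0 ≤ b) :
    ∫⁻ r in Ioo (0 : ℝ) 1, ENNReal.ofReal (a - hellingerWeight p r * b) =
      if b < a then ENNReal.ofReal ((a ^ p⁻¹ - b ^ p⁻¹) ^ p) else 0 := by
  have hp0 : p ≠ 0 := by linarith
  split_ifs with hab
  swap
  · refine (setLIntegral_congr_fun measurableSet_Ioo fun r hr => ?_).trans lintegral_zero
    have := one_le_hellingerWeight hp hr
    exact ENNReal.ofReal_of_nonpos (by nlinarith)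
  rcases hb.eq_or_lt with rfl | hb
  · simp [Real.zero_rpow (inv_ne_zero hp0), Real.rpow_inv_rpow ha hp0]
  -- Layer cake: `(a - λ b)₊` is the length of `{τ ∈ (b, a] : λ b < τ}`, where `λ ≥ 1` allows
  -- starting at `b`. Tonelli then exchanges `r` and `τ`.
  have h1 : ∀ r ∈ Ioo (0 : ℝ) 1, ENNReal.ofReal (a - hellingerWeight p r * b) =
      ∫⁻ τ in Ioc b a, (Ioi (hellingerWeight p r * b)).indicator 1 τ := by
    intro r hr
    have h2 : b ≤ hellingerWeight p r * b :=
      le_mul_of_one_le_left hb.le (one_le_hellingerWeight hp hr)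
    rw [lintegral_indicator_one measurableSet_Ioi, Measure.restrict_apply measurableSet_Ioi,
      inter_comm, Ioc_inter_Ioi, max_eq_right h2, Real.volume_Ioc]
  rw [setLIntegral_congr_fun measurableSet_Ioo h1, lintegral_lintegral_swap]
  swap
  · refine Measurable.aemeasurable ?_
    have : (Function.uncurry fun r τ => (Ioi (hellingerWeight p r * b)).indicator (1 : ℝ → ℝ≥0∞) τ) =
        {z : ℝ × ℝ | hellingerWeight p z.1 * b < z.2}.indicator 1 := by
      ext z; simp [indicator, Function.uncurry]
    rw [this]
    exact measurable_one.indicator (measurableSet_lt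
      (((measurable_hellingerWeight p).comp measurable_fst).mul_const b) measurable_snd)
  have h2 : ∀ τ ∈ Ioc b a, ∫⁻ r in Ioo (0 : ℝ) 1,
      (Ioi (hellingerWeight p r * b)).indicator (1 : ℝ → ℝ≥0∞) τ =
      ENNReal.ofReal ((1 - (b / τ) ^ p⁻¹) ^ (p - 1)) := by
    intro τ hτ
    have hτ0 : 0 < τ := hb.trans hτ.1
    have hR : (1 - (b / τ) ^ p⁻¹) ^ (p - 1) ≤ 1 := by
      have h3 : (b / τ) ^ p⁻¹ ≤ 1 :=
        Real.rpow_le_one (by positivity) ((div_le_one hτ0).2 hτ.1.le) (inv_pos.2 (by linarith)).le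
      have h4 : 0 ≤ (b / τ) ^ p⁻¹ := by positivity
      exact Real.rpow_le_one (by linarith) (by linarith) (by linarith)
    calc _ = ∫⁻ r in Ioo (0 : ℝ) 1, (Iio ((1 - (b / τ) ^ p⁻¹) ^ (p - 1))).indicator 1 r := by
          refine setLIntegral_congr_fun measurableSet_Ioo fun r hr => ?_
          simp only [indicator, mem_Ioi, mem_Iio, hellingerWeight_mul_lt_iff hp hr hb hτ.1.le,
            Pi.one_apply]
      _ = _ := by
        rw [lintegral_indicator_one measurableSet_Iio, Measure.restrict_apply measurableSet_Iio,
          inter_comm, Ioo_inter_Iio, min_eq_right hR, Real.volume_Ioo, sub_zero]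
  rw [setLIntegral_congr_fun measurableSet_Ioc h2, ← integral_hellinger_density hp hb hab.le,
    intervalIntegral.integral_of_le hab.le, ofReal_integral_eq_lintegral_ofReal]
  · have : IntervalIntegrable (fun τ => (1 - (b / τ) ^ p⁻¹) ^ (p - 1)) volume b a := by
      refine ContinuousOn.intervalIntegrable_of_Icc hab.le ?_
      refine ContinuousOn.rpow_const (continuousOn_const.sub ?_) fun x _ => Or.inr (by linarith)
      refine ContinuousOn.rpow_const ?_ fun x _ => Or.inr (by positivity)
      exact continuousOn_const.div continuousOn_id fun x hx => (hb.trans_le hx.1).ne'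
    exact (intervalIntegrable_iff_integrableOn_Ioc_of_le hab.le).1 this
  · filter_upwards [ae_restrict_mem measurableSet_Ioc] with τ hτ
    have h3 : (b / τ) ^ p⁻¹ ≤ 1 := Real.rpow_le_one (by have := hb.trans hτ.1; positivity)
      ((div_le_one (hb.trans hτ.1)).2 hτ.1.le) (inv_pos.2 (by linarith)).le
    exact Real.rpow_nonneg (by linarith) _

lemma ofReal_abs_rpow_sub_rpow {p : ℝ} (hp : 1 < p) {a b : ℝ} (ha : 0 ≤ a) (hb : 0 ≤ b) :
    ENNReal.ofReal (|a ^ (1 / p) - b ^ (1 / p)| ^ p) =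
      ∫⁻ r in Ioo (0 : ℝ) 1, ENNReal.ofReal (a - hellingerWeight p r * b) +
        ENNReal.ofReal (b - hellingerWeight p r * a) := by
  have hm := measurable_hellingerWeight p
  rw [lintegral_add_left (by fun_prop), lintegral_hellingerWeight hp ha hb,
    lintegral_hellingerWeight hp hb ha, one_div]
  have hq : 0 < p⁻¹ := inv_pos.2 (by linarith)
  rcases lt_trichotomy a b with h | rfl | h
  · rw [if_neg h.not_gt, if_pos h, zero_add, abs_sub_comm,
      abs_of_pos (sub_pos.2 (Real.rpow_lt_rpow ha h hq))]
  · simp [Real.zero_rpow (show p ≠ 0 by linarith)]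
  · rw [if_neg h.not_gt, if_pos h, add_zero,
      abs_of_pos (sub_pos.2 (Real.rpow_lt_rpow hb h hq))]

/-- Contraction of weighted positive parts implies contraction of all Hellinger distances. -/
theorem hellinger_le_of_forall_lintegral_le {α : Type*} [MeasurableSpace α] {μ : Measure α}
    [SFinite μ] {f g F G : α → ℝ} (hf : Measurable f) (hg : Measurable g) (hF : Measurable F)
    (hG : Measurable G) (hf0 : 0 ≤ᵐ[μ] f) (hg0 : 0 ≤ᵐ[μ] g) (hF0 : 0 ≤ᵐ[μ] F) (hG0 : 0 ≤ᵐ[μ] G)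
    (h1 : ∀ c : ℝ, 0 < c → ∫⁻ x, ENNReal.ofReal (F x - c * G x) ∂μ ≤
      ∫⁻ x, ENNReal.ofReal (f x - c * g x) ∂μ)
    (h2 : ∀ c : ℝ, 0 < c → ∫⁻ x, ENNReal.ofReal (G x - c * F x) ∂μ ≤
      ∫⁻ x, ENNReal.ofReal (g x - c * f x) ∂μ) {p : ℝ} (hp : 1 ≤ p) :
    hellinger μ p F G ≤ hellinger μ p f g := by
  unfold hellinger
  refine ENNReal.rpow_le_rpow ?_ (by positivity)
  rcases hp.eq_or_lt with rfl | hp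
  -- The kernel needs `p > 1`; for `p = 1` the integrand is simply the sum of both positive parts,
  -- with `c = 1`.
  · have e : ∀ {f g : α → ℝ}, Measurable f → Measurable g →
        ∫⁻ x, ENNReal.ofReal (|f x ^ ((1 : ℝ) / 1) - g x ^ ((1 : ℝ) / 1)| ^ (1 : ℝ)) ∂μ =
        ∫⁻ x, ENNReal.ofReal (f x - 1 * g x) ∂μ + ∫⁻ x, ENNReal.ofReal (g x - 1 * f x) ∂μ := by
      intro f g hf hg
      rw [← lintegral_add_left (by fun_prop)]
      refine lintegral_congr fun x => ?_
      simp only [div_one, Real.rpow_one, one_mul]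
      rcases le_total (f x) (g x) with h | h
      · rw [abs_sub_comm, abs_of_nonneg (sub_nonneg.2 h),
          ENNReal.ofReal_of_nonpos (sub_nonpos.2 h), zero_add]
      · rw [abs_of_nonneg (sub_nonneg.2 h), ENNReal.ofReal_of_nonpos (sub_nonpos.2 h), add_zero]
    rw [e hF hG, e hf hg]
    exact add_le_add (h1 1 one_pos) (h2 1 one_pos)
  · have e : ∀ {f g : α → ℝ}, Measurable f → Measurable g → 0 ≤ᵐ[μ] f → 0 ≤ᵐ[μ] g →
        ∫⁻ x, ENNReal.ofReal (|f x ^ (1 / p) - g x ^ (1 / p)| ^ p) ∂μ =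
        ∫⁻ r in Ioo (0 : ℝ) 1, (∫⁻ x, ENNReal.ofReal (f x - hellingerWeight p r * g x) ∂μ +
          ∫⁻ x, ENNReal.ofReal (g x - hellingerWeight p r * f x) ∂μ) := by
      intro f g hf hg hf0 hg0
      have hm := measurable_hellingerWeight p
      calc _ = ∫⁻ x, (∫⁻ r in Ioo (0 : ℝ) 1, ENNReal.ofReal (f x - hellingerWeight p r * g x) +
            ENNReal.ofReal (g x - hellingerWeight p r * f x)) ∂μ := by
            refine lintegral_congr_ae ?_
            filter_upwards [hf0, hg0] with x h1 h2
            exact ofReal_abs_rpow_sub_rpow hp h1 h2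
        _ = _ := by
          rw [lintegral_lintegral_swap (Measurable.aemeasurable (by fun_prop))]
          refine lintegral_congr fun r => ?_
          rw [lintegral_add_left (by fun_prop)]
    rw [e hF hG hF0 hG0, e hf hg hf0 hg0]
    refine setLIntegral_mono' measurableSet_Ioo fun r hr => ?_
    have hw := zero_lt_one.trans_le (one_le_hellingerWeight hp hr)
    exact add_le_add (h1 _ hw) (h2 _ hw)

end HellingerKernel

/-! ### Positive parts in `L¹` and density of `L¹ ∩ L²` -/

section LpOne

variable {α : Type*} [MeasurableSpace α] {μ : Measure α}

lemma enorm_eq_ofReal_add_ofReal_neg (a : ℝ) :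
    ‖a‖ₑ = ENNReal.ofReal a + ENNReal.ofReal (-a) := by
  rw [← ofReal_norm, Real.norm_eq_abs]
  rcases le_total 0 a with h | h
  · rw [abs_of_nonneg h, ENNReal.ofReal_of_nonpos (neg_nonpos.2 h), add_zero]
  · rw [abs_of_nonpos h, ENNReal.ofReal_of_nonpos h, zero_add]

lemma lintegral_enorm_sub_eq {f g : α → ℝ} (hf : AEMeasurable f μ) (hg : AEMeasurable g μ) :
    ∫⁻ x, ‖f x - g x‖ₑ ∂μ =
      ∫⁻ x, ENNReal.ofReal (f x - g x) ∂μ + ∫⁻ x, ENNReal.ofReal (g x - f x) ∂μ := by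
  have hfg : AEMeasurable (fun x => ENNReal.ofReal (f x - g x)) μ := (hf.sub hg).ennreal_ofReal
  rw [← lintegral_add_left' hfg]
  refine lintegral_congr fun x => ?_
  rw [enorm_eq_ofReal_add_ofReal_neg, neg_sub]

lemma lintegral_ofReal_Lp_one (w : Lp ℝ 1 μ) :
    ∫⁻ x, ENNReal.ofReal (w x) ∂μ = ENNReal.ofReal ‖Lp.posPart w‖ := by
  rw [Lp.norm_def, ENNReal.ofReal_toReal (Lp.eLpNorm_ne_top _), eLpNorm_one_eq_lintegral_enorm]
  refine lintegral_congr_ae ?_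
  filter_upwards [Lp.coeFn_posPart w] with x hx
  rw [hx, Real.enorm_of_nonneg (le_max_right _ _)]
  rcases le_total 0 (w x) with h | h
  · rw [max_eq_left h]
  · rw [max_eq_right h, ENNReal.ofReal_of_nonpos h, ENNReal.ofReal_zero]

/-- Written as the norm of a positive part, the integral is visibly continuous in `(f, g)`, as the
density argument requires. -/
lemma lintegral_ofReal_sub_Lp_one (f g : Lp ℝ 1 μ) (c : ℝ) :
    ∫⁻ x, ENNReal.ofReal (f x - c * g x) ∂μ = ENNReal.ofReal ‖Lp.posPart (f - c • g)‖ := by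
  rw [← lintegral_ofReal_Lp_one]
  refine lintegral_congr_ae ?_
  filter_upwards [Lp.coeFn_sub f (c • g), Lp.coeFn_smul c g] with x h1 h2
  rw [h1, Pi.sub_apply, h2, Pi.smul_apply, smul_eq_mul]

lemma exists_memLp_one_memLp_two_approx {f : α → ℝ} (hf : MemLp f 1 μ) {ε : ℝ≥0∞} (hε : ε ≠ 0) :
    ∃ g : α → ℝ, eLpNorm (f - g) 1 μ ≤ ε ∧ (MemLp g 1 μ ∧ MemLp g 2 μ) := by
  refine hf.induction_dense ENNReal.one_ne_top (fun g => MemLp g 1 μ ∧ MemLp g 2 μ) ?_ ?_ ?_ hε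
  · intro c s hs hsm ε _
    refine ⟨s.indicator fun _ => c, ?_, memLp_indicator_const 1 hs c (Or.inr hsm.ne),
      memLp_indicator_const 2 hs c (Or.inr hsm.ne)⟩
    rw [sub_self, eLpNorm_zero]
    exact zero_le
  · exact fun _ _ h1 h2 => ⟨h1.1.add h2.1, h1.2.add h2.2⟩
  · exact fun g hg => hg.1.1

/-- Integrable functions that are also square integrable form a dense subset of `L¹`. -/
lemma dense_memLp_two : Dense {f : Lp ℝ 1 μ | MemLp f 2 μ} := by
  intro f
  refine EMetric.mem_closure_iff.2 fun ε hε => ?_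
  obtain ⟨ε', hε', hεlt⟩ := exists_between hε
  obtain ⟨g, hg1, hg2⟩ := exists_memLp_one_memLp_two_approx (Lp.memLp f) hε'.ne'
  refine ⟨hg2.1.toLp g, hg2.2.ae_eq hg2.1.coeFn_toLp.symm, ?_⟩
  rw [Lp.edist_def]
  refine lt_of_le_of_lt (le_trans (le_of_eq (eLpNorm_congr_ae ?_)) hg1) hεlt
  filter_upwards [hg2.1.coeFn_toLp] with x hx
  rw [Pi.sub_apply, Pi.sub_apply, hx]

end LpOne

/-! ### The heat semigroup on `L¹` -/

section L1Semigroup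

variable {X : Type*} [MetricSpace X] [MeasurableSpace X] [BorelSpace X] {m : Measure X}

lemma lintegral_enorm_heatFlow_sub_le {f g : Lp ℝ 2 m} {u v : ℝ → Lp ℝ 2 m}
    (hu : IsL2HeatFlow m f u) (hv : IsL2HeatFlow m g v) {t : ℝ} (ht : 0 ≤ t) :
    ∫⁻ x, ‖u t x - v t x‖ₑ ∂m ≤ ∫⁻ x, ‖f x - g x‖ₑ ∂m := by
  have hm : ∀ w : Lp ℝ 2 m, AEMeasurable w m := fun w => (Lp.aestronglyMeasurable w).aemeasurable
  rw [lintegral_enorm_sub_eq (hm _) (hm _), lintegral_enorm_sub_eq (hm _) (hm _)]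
  exact add_le_add (lintegral_heatFlow_sub_le hu hv ht) (lintegral_heatFlow_sub_le hv hu ht)

lemma IsL2HeatFlow.memLp_one {f : Lp ℝ 2 m} {u : ℝ → Lp ℝ 2 m} (hu : IsL2HeatFlow m f u)
    (hf : MemLp f 1 m) {t : ℝ} (ht : 0 ≤ t) : MemLp (u t) 1 m := by
  refine ⟨Lp.aestronglyMeasurable _, ?_⟩
  have h := lintegral_enorm_heatFlow_sub_le hu isL2HeatFlow_zero ht
  have e : ∀ w : Lp ℝ 2 m, ∫⁻ x, ‖w x - (0 : Lp ℝ 2 m) x‖ₑ ∂m = eLpNorm w 1 m := fun w => by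
    rw [eLpNorm_one_eq_lintegral_enorm]
    refine lintegral_congr_ae ?_
    filter_upwards [Lp.coeFn_zero ℝ 2 m] with x hx
    rw [hx, Pi.zero_apply, sub_zero]
  rw [e, e] at h
  exact h.trans_lt hf.2

/-- The heat flow on `L¹ ∩ L²`, as a map into `L¹`. -/
lemma exists_heatFlow_one [SecondCountableTopology (Lp ℝ 2 m)] (hΦ : IsConvexEnergy (cheeger m))
    (t : ℝ≥0) : ∃ T : {f : Lp ℝ 1 m | MemLp f 2 m} → Lp ℝ 1 m, LipschitzWith 1 T ∧
      ∀ f, T f =ᵐ[m] (gradientFlow (cheeger m) t (f.2.toLp f.1) : Lp ℝ 2 m) := by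
  have hfl : ∀ f : {f : Lp ℝ 1 m | MemLp f 2 m}, IsL2HeatFlow m (f.2.toLp f.1)
      fun t => gradientFlow (cheeger m) t (f.2.toLp f.1) := fun f => isL2HeatFlow_gradientFlow hΦ _
  have hmem : ∀ f : {f : Lp ℝ 1 m | MemLp f 2 m},
      MemLp (gradientFlow (cheeger m) t (f.2.toLp f.1) : Lp ℝ 2 m) 1 m := fun f =>
    (hfl f).memLp_one ((Lp.memLp f.1).ae_eq f.2.coeFn_toLp.symm) (NNReal.coe_nonneg t)
  refine ⟨fun f => (hmem f).toLp _, fun f g => ?_, fun f => (hmem f).coeFn_toLp⟩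
  rw [ENNReal.coe_one, one_mul, Subtype.edist_eq, Lp.edist_def, Lp.edist_def,
    eLpNorm_one_eq_lintegral_enorm, eLpNorm_one_eq_lintegral_enorm]
  have h := lintegral_enorm_heatFlow_sub_le (hfl f) (hfl g) (NNReal.coe_nonneg t)
  refine le_trans (le_of_eq ?_) (h.trans (le_of_eq ?_))
  · refine lintegral_congr_ae ?_
    filter_upwards [(hmem f).coeFn_toLp, (hmem g).coeFn_toLp] with x h1 h2
    rw [Pi.sub_apply, h1, h2]
  · refine lintegral_congr_ae ?_
    filter_upwards [f.2.coeFn_toLp, g.2.coeFn_toLp] with x h1 h2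
    rw [Pi.sub_apply, h1, h2]

theorem exists_isL1HeatSemigroup [SecondCountableTopology (Lp ℝ 2 m)]
    (hΦ : IsConvexEnergy (cheeger m)) : ∃ P, IsL1HeatSemigroup m P := by
  choose T hTl hT using exists_heatFlow_one hΦ
  have hind := (isUniformEmbedding_subtype_val
    (p := fun f : Lp ℝ 1 m => f ∈ {f : Lp ℝ 1 m | MemLp f 2 m})).isUniformInducing
  have hd : DenseRange ((↑) : {f : Lp ℝ 1 m | MemLp f 2 m} → Lp ℝ 1 m) :=
    dense_memLp_two.denseRange_val
  refine ⟨fun t => (hind.isDenseInducing hd).extend (T t), fun f f' hff' => ?_, fun t =>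
    (uniformContinuous_uniformly_extend hind hd (hTl t).uniformContinuous).continuous⟩
  have hf2 : MemLp f 2 m := (Lp.memLp f').ae_eq hff'.symm
  have e : hf2.toLp f = f' := by
    apply Lp.ext
    exact hf2.coeFn_toLp.trans hff'
  refine ⟨_, isL2HeatFlow_gradientFlow hΦ f', fun t => ?_⟩
  have h := (hind.isDenseInducing hd).extend_eq (hTl t).continuous ⟨f, hf2⟩
  have h2 := hT t ⟨f, hf2⟩
  simp only at h h2
  rw [h]
  rw [e] at h2
  exact h2

theorem IsL1HeatSemigroup.unique {P Q : ℝ≥0 → Lp ℝ 1 m → Lp ℝ 1 m}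
    (hP : IsL1HeatSemigroup m P) (hQ : IsL1HeatSemigroup m Q) : P = Q := by
  funext t
  refine Continuous.ext_on dense_memLp_two (hP.continuous t) (hQ.continuous t) fun f hf => ?_
  obtain ⟨u, hu, hPu⟩ := hP.eq_flow f (hf.toLp f) hf.coeFn_toLp.symm
  obtain ⟨v, hv, hQv⟩ := hQ.eq_flow f (hf.toLp f) hf.coeFn_toLp.symm
  apply Lp.ext
  refine (hPu t).trans (EventuallyEq.trans ?_ (hQv t).symm)
  rw [hu.unique hv (NNReal.coe_nonneg t)]

/-- The inequality is a closed condition on `L¹ × L¹`. On the dense set of square integrable pairs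
it compares the flow of `f` with `c` times the flow of `g`, itself a flow by homogeneity. -/
theorem IsL1HeatSemigroup.norm_posPart_sub_le {P : ℝ≥0 → Lp ℝ 1 m → Lp ℝ 1 m}
    (hP : IsL1HeatSemigroup m P) (t : ℝ≥0) {c : ℝ} (hc : 0 < c) (f g : Lp ℝ 1 m) :
    ‖Lp.posPart (P t f - c • P t g)‖ ≤ ‖Lp.posPart (f - c • g)‖ := by
  have hcl : IsClosed {z : Lp ℝ 1 m × Lp ℝ 1 m |
      ‖Lp.posPart (P t z.1 - c • P t z.2)‖ ≤ ‖Lp.posPart (z.1 - c • z.2)‖} := by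
    refine isClosed_le (continuous_norm.comp (Lp.continuous_posPart.comp ?_))
      (continuous_norm.comp (Lp.continuous_posPart.comp ?_))
    · exact ((hP.continuous t).comp continuous_fst).sub
        (((hP.continuous t).comp continuous_snd).const_smul c)
    · exact continuous_fst.sub (continuous_snd.const_smul c)
  have hsub : {f : Lp ℝ 1 m | MemLp f 2 m} ×ˢ {f : Lp ℝ 1 m | MemLp f 2 m} ⊆
      {z : Lp ℝ 1 m × Lp ℝ 1 m |
      ‖Lp.posPart (P t z.1 - c • P t z.2)‖ ≤ ‖Lp.posPart (z.1 - c • z.2)‖} := by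
    rintro ⟨f, g⟩ ⟨hf, hg⟩
    have hf : MemLp f 2 m := hf
    have hg : MemLp g 2 m := hg
    obtain ⟨u, hu, hPu⟩ := hP.eq_flow f (hf.toLp f) hf.coeFn_toLp.symm
    obtain ⟨v, hv, hPv⟩ := hP.eq_flow g (hg.toLp g) hg.coeFn_toLp.symm
    have h := lintegral_heatFlow_sub_le hu (hv.smul hc) (NNReal.coe_nonneg t)
    have e1 : ∫⁻ x, ENNReal.ofReal (u t x - (c • v t : Lp ℝ 2 m) x) ∂m =
        ∫⁻ x, ENNReal.ofReal (P t f x - c * P t g x) ∂m := by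
      refine lintegral_congr_ae ?_
      filter_upwards [hPu t, hPv t, Lp.coeFn_smul c (v t)] with x h1 h2 h3
      rw [h1, h2, h3, Pi.smul_apply, smul_eq_mul]
    have e2 : ∫⁻ x, ENNReal.ofReal (hf.toLp f x - (c • hg.toLp g : Lp ℝ 2 m) x) ∂m =
        ∫⁻ x, ENNReal.ofReal (f x - c * g x) ∂m := by
      refine lintegral_congr_ae ?_
      filter_upwards [hf.coeFn_toLp, hg.coeFn_toLp, Lp.coeFn_smul c (hg.toLp g)] with x h1 h2 h3
      rw [h3, Pi.smul_apply, smul_eq_mul, h1, h2]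
    have h' := e1.symm.trans_le (h.trans_eq e2)
    rw [lintegral_ofReal_sub_Lp_one, lintegral_ofReal_sub_Lp_one] at h'
    exact (ENNReal.ofReal_le_ofReal_iff (norm_nonneg _)).1 h'
  have := (hcl.closure_subset_iff.2 hsub) ((dense_memLp_two.prod dense_memLp_two) (f, g))
  exact this

theorem IsL1HeatSemigroup.lintegral_sub_le {P : ℝ≥0 → Lp ℝ 1 m → Lp ℝ 1 m}
    (hP : IsL1HeatSemigroup m P) (t : ℝ≥0) {c : ℝ} (hc : 0 < c) (f g : Lp ℝ 1 m) :
    ∫⁻ x, ENNReal.ofReal (P t f x - c * P t g x) ∂m ≤ ∫⁻ x, ENNReal.ofReal (f x - c * g x) ∂m := by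
  rw [lintegral_ofReal_sub_Lp_one, lintegral_ofReal_sub_Lp_one]
  exact ENNReal.ofReal_le_ofReal (hP.norm_posPart_sub_le t hc f g)

lemma IsL1HeatSemigroup.map_zero {P : ℝ≥0 → Lp ℝ 1 m → Lp ℝ 1 m}
    (hP : IsL1HeatSemigroup m P) (t : ℝ≥0) : P t 0 = 0 := by
  have e : (0 : Lp ℝ 1 m) =ᵐ[m] (0 : Lp ℝ 2 m) :=
    (Lp.coeFn_zero ℝ 1 m).trans (Lp.coeFn_zero ℝ 2 m).symm
  obtain ⟨u, hu, hPu⟩ := hP.eq_flow 0 0 e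
  apply Lp.ext
  have h := hPu t
  rw [hu.unique isL2HeatFlow_zero (NNReal.coe_nonneg t)] at h
  exact h.trans e.symm

/-- Comparison with the zero solution: `∫ (0 - P_t f)₊ ≤ ∫ (0 - f)₊ = 0`. -/
theorem IsL1HeatSemigroup.nonneg {P : ℝ≥0 → Lp ℝ 1 m → Lp ℝ 1 m}
    (hP : IsL1HeatSemigroup m P) (t : ℝ≥0) {f : Lp ℝ 1 m} (hf : 0 ≤ f) : 0 ≤ P t f := by
  have h := hP.lintegral_sub_le t one_pos 0 f
  have hf' := (Lp.coeFn_nonneg f).2 hf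
  have e : ∫⁻ x, ENNReal.ofReal ((0 : Lp ℝ 1 m) x - 1 * f x) ∂m = 0 := by
    refine (lintegral_congr_ae ?_).trans lintegral_zero
    filter_upwards [hf', Lp.coeFn_zero ℝ 1 m] with x h1 h2
    rw [h2]
    exact ENNReal.ofReal_of_nonpos (by simpa using h1)
  rw [e, hP.map_zero, nonpos_iff_eq_zero, lintegral_eq_zero_iff'] at h
  · refine (Lp.coeFn_nonneg _).1 ?_
    filter_upwards [h, Lp.coeFn_zero ℝ 1 m] with x h1 h2
    rw [h2] at h1
    simpa using h1
  · exact ((Lp.aestronglyMeasurable _).aemeasurable.sub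
      ((Lp.aestronglyMeasurable _).aemeasurable.const_mul 1)).ennreal_ofReal

omit [BorelSpace X] in
lemma measure_ball_lt_top_of_growth {o : X} {φ : ℝ → ℝ}
    (h : ∀ r : ℝ, 0 < r → m (Metric.ball o r) ≤ ENNReal.ofReal (φ r)) (x : X) (r : ℝ) :
    m (Metric.ball x r) < ∞ := by
  have hr : 0 < |r| + dist x o + 1 := by positivity
  refine lt_of_le_of_lt (measure_mono ?_) ((h _ hr).trans_lt ENNReal.ofReal_lt_top)
  exact Metric.ball_subset_ball' (by linarith [le_abs_self r])

end L1Semigroup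

end HeatHellinger

end

/-! ### The main theorem -/

theorem mainTheorem5 {X : Type*} [MetricSpace X] [CompleteSpace X]
    [TopologicalSpace.SeparableSpace X] [MeasurableSpace X] [BorelSpace X]
    (m : Measure X) [m.IsOpenPosMeasure]
    (hgrowth : ∃ (o : X) (κ : ℝ), 0 ≤ κ ∧
      ∀ r : ℝ, 0 < r → m (Metric.ball o r) ≤ ENNReal.ofReal (Real.exp (κ * r ^ 2))) :
    (∃! P : ℝ≥0 → Lp ℝ 1 m → Lp ℝ 1 m, HeatHellinger.IsL1HeatSemigroup m P) ∧
    ∀ P : ℝ≥0 → Lp ℝ 1 m → Lp ℝ 1 m, HeatHellinger.IsL1HeatSemigroup m P →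
      ∀ f g : Lp ℝ 1 m, 0 ≤ f → 0 ≤ g → ∀ t : ℝ≥0,
        0 ≤ P t f ∧ 0 ≤ P t g ∧
        ∀ p : ℝ, 1 ≤ p →
          HeatHellinger.hellinger m p (P t f) (P t g) ≤ HeatHellinger.hellinger m p f g := by
  obtain ⟨o, κ, -, hκ⟩ := hgrowth
  have hm := HeatHellinger.measure_ball_lt_top_of_growth hκ
  have : SecondCountableTopology X := UniformSpace.secondCountable_of_separable X
  -- Local finiteness and the finite exponent serve the separability of `L²`, on which
  -- differentiability of the flow depends.
  have : IsLocallyFiniteMeasure m :=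
    ⟨fun x => ⟨Metric.ball x 1, Metric.ball_mem_nhds x one_pos, hm x 1⟩⟩
  have : Fact ((2 : ℝ≥0∞) ≠ ∞) := ⟨by simp⟩
  obtain ⟨P₀, hP₀⟩ := HeatHellinger.exists_isL1HeatSemigroup
    (HeatHellinger.isConvexEnergy_cheeger hm)
  refine ⟨⟨P₀, hP₀, fun Q hQ => hQ.unique hP₀⟩, fun P hP f g hf hg t => ?_⟩
  refine ⟨hP.nonneg t hf, hP.nonneg t hg, fun p hp => ?_⟩
  exact HeatHellinger.hellinger_le_of_forall_lintegral_le
    (Lp.stronglyMeasurable f).measurable (Lp.stronglyMeasurable g).measurable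
    (Lp.stronglyMeasurable _).measurable (Lp.stronglyMeasurable _).measurable
    ((Lp.coeFn_nonneg f).2 hf) ((Lp.coeFn_nonneg g).2 hg)
    ((Lp.coeFn_nonneg _).2 (hP.nonneg t hf)) ((Lp.coeFn_nonneg _).2 (hP.nonneg t hg))
    (fun c hc => hP.lintegral_sub_le t hc f g) (fun c hc => hP.lintegral_sub_le t hc g f) hp
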